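/- Let $\Omega=[0,1]\times[-1,1]$ with coordinates $(r,z)$ and $U=\{(x,y):x^2+y^2\le 1\}\times[-1,1]\subset\mathbb R^3$. A function $u$ of $(r,z)$ is identified with the axisymmetric function $(x,y,z)\mapsto u(\sqrt{x^2+y^2},z)$, and its Abel transform is $$\mathcal A u(x,z)=2\int_x^\infty \frac{u(r,z)\,r}{\sqrt{r^2-x^2}}\,dr .$$ (For a function given only on $\Omega$, it is first extended by zero.) Let $\|u\|_{TV(\Omega)}=\sup\{\iint_\Omega u\,\mathrm{div}\,\phi\,dr\,dz:\phi\in C^1_c(\Omega^\circ;\mathbb R^2),\ |\phi|\le1\}$, let $BV(\Omega)$ be the space of $u\in L^1(\Omega)$ with $\|u\|_{TV(\Omega)}<\infty$, and for $c,M\ge 0$ let $$\mathcal S(c,M)=\{u\in BV(\Omega):\|u\|_{TV(\Omega)}\le c,\ \|u\|_{L^\infty(\Omega)}\le M,\ \|\mathcal A u\|_{L^2(\Omega)}<\infty\}.$$ There is an absolute constant $K$ such that the following holds for all $c,M,\sigma\ge0$, all $\lambda>0$, every class $V\subseteq BV(\Omega)$ of admissible functions (for example $V=BV(\Omega)$)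 and every $u_0\in\mathcal S(c,M)$ with $\operatorname{supp}u_0\subset[0,1)\times[-1,1]$. Put $f_0=\mathcal A u_0$ and $f=f_0+\eta$, and let $u^*\in\mathcal S(c,M)$, with $\operatorname{supp}u^*\subset[0,1)\times[-1,1]$, be a minimizer of $$u\mapsto\|u\|_{TV(\Omega)}+\tfrac{\lambda}{2}\|\mathcal A u-f\|_{L^2(\Omega)}^2\qquad(u\in V).$$ (a) If $\eta\in L^2(\Omega)$ is a noise function with mean square $\frac1{|\Omega|}\int_\Omega\eta^2\le\sigma^2$, then $$\|u^*-u_0\|_{L^2(U)}\le K(cM)^{1/3}\left(\|\mathcal A u^*-f\|_{L^2(\Omega)}+\sqrt2\,\sigma\right)^{1/3}.$$ (b) If $\eta$ is a jointly measurable random field with $\eta(p)\sim\mathrm{Normal}(0,\sigma^2)$ for almost every $p\in\Omega$, and $u^*$ is a jointly measurable random function that almost surely is as above, then $\mathbb E\|f-f_0\|_{L^2(\Omega)}^2=2\sigma^2$; almost surely $$\|u^*-u_0\|_{L^2(U)}\le K(cM)^{1/3}\left(\|\mathcal A u^*-f\|_{L^2(\Omega)}+\|f-f_0\|_{L^2(\Omega)}\right)^{1/3};$$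 and $$\left(\mathbb E\|u^*-u_0\|_{L^2(U)}^3\right)^{1/3}\le K(cM)^{1/3}\left(\mathbb E\|\mathcal A u^*-f\|_{L^2(\Omega)}+\sqrt2\,\sigma\right)^{1/3}.$$ -/

import Mathlib

open MeasureTheory ProbabilityTheory Set
open scoped ENNReal NNReal

noncomputable section

namespace AbelTV

/-- The rectangle `Ω = [0,1] × [-1,1]` of the cylindrical coordinates `(r, z)`. -/
def rect : Set (ℝ × ℝ) := Icc (0 : ℝ) 1 ×ˢ Icc (-1 : ℝ) 1

/-- The solid cylinder `U = {x² + y² ≤ 1} × [-1,1]`; a point of `ℝ³` is written `(x, y, z)`. -/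
def cylinder : Set (ℝ × ℝ × ℝ) :=
  {p | p.1 ^ 2 + p.2.1 ^ 2 ≤ 1 ∧ p.2.2 ∈ Icc (-1 : ℝ) 1}

/-- The axisymmetric function on `ℝ³` with profile `u`, that is `(x, y, z) ↦ u (√(x² + y²), z)`. -/
def axisymmetric (u : ℝ × ℝ → ℝ) : ℝ × ℝ × ℝ → ℝ :=
  fun p => u (Real.sqrt (p.1 ^ 2 + p.2.1 ^ 2), p.2.2)

/-- The Abel transform `𝒜 u (x, z) = 2 ∫_x^∞ u (r, z) r / √(r² - x²) dr` of a profile `u`. -/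
def abelTransform (u : ℝ × ℝ → ℝ) : ℝ × ℝ → ℝ :=
  fun p => 2 * ∫ r in Ioi p.1, u (r, p.2) * r / Real.sqrt (r ^ 2 - p.1 ^ 2)

/-- The supports of the profiles are contained in `[0,1) × [-1,1]`. -/
def SupportedInside (u : ℝ × ℝ → ℝ) : Prop :=
  tsupport u ⊆ Ico (0 : ℝ) 1 ×ˢ Icc (-1 : ℝ) 1

/-- The test fields `φ = (φ₁, φ₂) ∈ C_c^1(Ω; ℝ²)` with `|φ| ≤ 1` (Euclidean norm);
compact support is in the interior of the rectangle. -/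
structure IsTestField (φ₁ φ₂ : ℝ × ℝ → ℝ) : Prop where
  contDiff_fst : ContDiff ℝ 1 φ₁
  contDiff_snd : ContDiff ℝ 1 φ₂
  compact_fst : HasCompactSupport φ₁
  compact_snd : HasCompactSupport φ₂
  supp_fst : tsupport φ₁ ⊆ interior rect
  supp_snd : tsupport φ₂ ⊆ interior rect
  norm_le : ∀ p, φ₁ p ^ 2 + φ₂ p ^ 2 ≤ 1

/-- The divergence of `(φ₁, φ₂)` in the coordinates `(r, z)`. -/
def divergence (φ₁ φ₂ : ℝ × ℝ → ℝ) (p : ℝ × ℝ) : ℝ :=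
  fderiv ℝ φ₁ p (1, 0) + fderiv ℝ φ₂ p (0, 1)

/-- The total variation of `u` in `Ω` (with values in `[0, ∞]`). -/
def totalVariation (u : ℝ × ℝ → ℝ) : ℝ≥0∞ :=
  ⨆ (φ₁ : ℝ × ℝ → ℝ) (φ₂ : ℝ × ℝ → ℝ) (_ : IsTestField φ₁ φ₂),
    ENNReal.ofReal (∫ p in rect, u p * divergence φ₁ φ₂ p)

/-- The space `BV(Ω)`; only the values on `Ω` matter. -/
def bvSpace : Set (ℝ × ℝ → ℝ) :=
  {u | IntegrableOn u rect ∧ totalVariation u < ∞}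

/-- The Abel transform of a function given on `Ω`, extended by zero. -/
def abelOn (u : ℝ × ℝ → ℝ) : ℝ × ℝ → ℝ := abelTransform (rect.indicator u)

/-- The objective `‖u‖_TV + (lam / 2) ‖𝒜 u - f‖²_{L²(Ω)}`. -/
def tvObjective (lam : ℝ) (f u : ℝ × ℝ → ℝ) : ℝ≥0∞ :=
  totalVariation u +
    ENNReal.ofReal (lam / 2) * eLpNorm (abelOn u - f) 2 (volume.restrict rect) ^ 2

/-- `u` minimizes the objective over the class `V`. -/
def IsTVMinimizer (V : Set (ℝ × ℝ → ℝ)) (lam : ℝ) (f u : ℝ × ℝ → ℝ) : Prop :=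
  u ∈ V ∧ IsMinOn (tvObjective lam f) V u

/-- The class of all `u ∈ BV(Ω)` with `‖u‖_TV ≤ c`, `‖u‖_∞ ≤ M` and `‖𝒜 u‖_{L²(Ω)} < ∞`. -/
def boundedClass (c M : ℝ≥0) : Set (ℝ × ℝ → ℝ) :=
  {u | u ∈ bvSpace ∧ totalVariation u ≤ c ∧
    eLpNorm u ∞ (volume.restrict rect) ≤ M ∧
    eLpNorm (abelOn u) 2 (volume.restrict rect) < ∞}

/-- `‖u - w‖_{L²(U)}` for the axisymmetric functions with profiles `u` and `w`. -/
def distU (u w : ℝ × ℝ → ℝ) : ℝ≥0∞ :=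
  eLpNorm (axisymmetric u - axisymmetric w) 2 (volume.restrict cylinder)

end AbelTV

end

/-!
The minimality of `u*` plays no role: any two functions `u`, `u₀` of the bounded class satisfy
`‖u - u₀‖_{L²(U)}³ ≤ K³ c M ‖𝒜 u - 𝒜 u₀‖_{L²(Ω)}` (`AbelTV.distU_pow_three_le`). The triangle
inequality then gives the estimates with noise, and Tonelli's theorem and the Cauchy-Schwarz
inequality their mean.

The stability estimate becomes transparent in the squared radius `t = r²`. Put `v = u - u₀` and
`w (t, z) = v (√t, z)`. Then `‖v‖²_{L²(U)} = π ∫ w²`, and with `κ (s) = s₊^(-1/2)` the Abel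
transform is half-order integration in `t`, `𝒜 v (x, z) = G (x², z)` for
`G (y, z) = ∫ κ (s) w (y + s, z) ds` (`AbelTV.abelTransform_eq_halfIntegral`). In particular
`∫ G² ≤ 2 ‖𝒜 v‖²_{L²(Ω)}`, the integral being over `y > 0`. Total variation is
invariant under the substitution, so the variation of `w` in `t` is at most `C = 2 c`
(`AbelTV.IsInnerProfile.fstVariationLE`), and `|w| ≤ m = 2 M`.

Let `w_h (t, z) = h⁻¹ ∫₀ʰ w (t + s, z) ds` and split `∫ w² = ∫ w w_h + ∫ (w - w_h) w`.
* Since `κ ∗ κ = π` on `(0, ∞)`, the means are recovered from `G` by the absolutely convergent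
  formula `w_h = (π h)⁻¹ ∫ (κ (s) - κ (s - h)) G (· + s) ds`, whose kernel has `L¹` norm at most
  `4 √h`. Young's inequality yields `∫ w w_h ≤ ½ ∫ w² + h⁻¹ ∫ G²` for `h ≤ 1`
  (`AbelTV.IsProfile.integral_mul_segmentMean_le`).
* A smooth test function `ψ` minus its mean over segments of length `h` is the `t`-derivative of a
  test function of size at most `h sup |ψ|`. Approximating `w` by such `ψ` gives
  `∫ (w - w_h) w ≤ C m h` (`AbelTV.IsProfile.integral_sub_segmentMean_mul_self_le`).

Hence `∫ w² ≤ 2 h⁻¹ ∫ G² + 2 C m h` for `0 < h ≤ 1`. For `h = 2` the segment leaves the support,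
so `∫ w w_h ≤ ½ ∫ w²` and `∫ w² ≤ 4 C m`. Optimizing over `h` gives the exponent `1/3`
(`AbelTV.IsProfile.integral_sq_pow_three_le`).
-/

namespace AbelTV

/-! ### The half-integration kernel -/

/-- The kernel `s ↦ s₊^(-1/2)` of half-order integration. The conventions `√s = 0` for `s ≤ 0` and
`0⁻¹ = 0` make it vanish on `(-∞, 0]`. -/
noncomputable def invSqrt (s : ℝ) : ℝ := (Real.sqrt s)⁻¹

lemma invSqrt_nonneg (s : ℝ) : 0 ≤ invSqrt s := inv_nonneg.2 (Real.sqrt_nonneg s)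

lemma invSqrt_of_nonpos {s : ℝ} (hs : s ≤ 0) : invSqrt s = 0 := by
  simp [invSqrt, Real.sqrt_eq_zero_of_nonpos hs]

lemma measurable_invSqrt : Measurable invSqrt := Real.continuous_sqrt.measurable.inv

lemma hasDerivAt_two_mul_sqrt {s : ℝ} (hs : 0 < s) :
    HasDerivAt (fun x => 2 * Real.sqrt x) (invSqrt s) s := by
  have h := (Real.hasDerivAt_sqrt hs.ne').const_mul 2
  convert! h using 1
  have := Real.sqrt_pos.2 hs
  unfold invSqrt
  field_simp

lemma integrableOn_invSqrt_Ioc {b : ℝ} : IntegrableOn invSqrt (Ioc 0 b) := by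
  refine intervalIntegral.integrableOn_deriv_of_nonneg (g := fun x => 2 * Real.sqrt x)
    (by fun_prop) (fun x hx => hasDerivAt_two_mul_sqrt hx.1) (fun x _ => invSqrt_nonneg x)

lemma indicator_invSqrt_Iic (b : ℝ) :
    (Iic b).indicator invSqrt = (Ioc 0 b).indicator invSqrt := by
  ext s
  by_cases h0 : 0 < s
  · by_cases hb : s ≤ b <;> simp [indicator, h0, hb]
  · simp [indicator, h0, invSqrt_of_nonpos (not_lt.1 h0)]

lemma integrableOn_invSqrt_Iic (b : ℝ) : IntegrableOn invSqrt (Iic b) := by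
  rw [← integrable_indicator_iff measurableSet_Iic, indicator_invSqrt_Iic,
    integrable_indicator_iff measurableSet_Ioc]
  exact integrableOn_invSqrt_Ioc

lemma integral_invSqrt_Iic {b : ℝ} (hb : 0 ≤ b) : ∫ s in Iic b, invSqrt s = 2 * Real.sqrt b := by
  rw [← integral_indicator measurableSet_Iic, indicator_invSqrt_Iic,
    integral_indicator measurableSet_Ioc, ← intervalIntegral.integral_of_le hb,
    intervalIntegral.integral_eq_sub_of_hasDerivAt_of_le hb (f := fun x => 2 * Real.sqrt x)
      (by fun_prop) (fun x hx => hasDerivAt_two_mul_sqrt hx.1)]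
  · simp
  · rw [intervalIntegrable_iff_integrableOn_Ioc_of_le hb]
    exact integrableOn_invSqrt_Ioc

/-- An antiderivative of the integrand of the Beta integral `B(1/2, 1/2)`. -/
lemma hasDerivAt_arcsin_affine {τ s : ℝ} (hs : s ∈ Ioo 0 τ) :
    HasDerivAt (fun x => Real.arcsin (2 * x / τ - 1)) (invSqrt s * invSqrt (τ - s)) s := by
  have hτ : 0 < τ := hs.1.trans hs.2
  have h1 : 2 * s / τ - 1 ≠ -1 := by
    have : 0 < 2 * s / τ := by have := hs.1; positivity
    linarith
  have h2 : 2 * s / τ - 1 ≠ 1 := by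
    have : 2 * s / τ < 2 := by rw [div_lt_iff₀ hτ]; linarith [hs.2]
    linarith
  have h3 : HasDerivAt (fun x => 2 * x / τ - 1) (2 / τ) s := by
    simpa using (((hasDerivAt_id s).const_mul 2).div_const τ).sub_const 1
  convert! (Real.hasDerivAt_arcsin h1 h2).comp s h3 using 1
  have h4 : 1 - (2 * s / τ - 1) ^ 2 = (2 / τ) ^ 2 * (s * (τ - s)) := by field_simp; ring
  rw [h4, Real.sqrt_mul (by positivity), Real.sqrt_sq (by positivity), Real.sqrt_mul hs.1.le]
  unfold invSqrt
  field_simp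

lemma integrableOn_invSqrt_mul_invSqrt (τ : ℝ) :
    IntegrableOn (fun s => invSqrt s * invSqrt (τ - s)) (Ioc 0 τ) := by
  refine intervalIntegral.integrableOn_deriv_of_nonneg
    (g := fun x => Real.arcsin (2 * x / τ - 1)) ?_ (fun x hx => hasDerivAt_arcsin_affine hx)
    (fun x _ => mul_nonneg (invSqrt_nonneg _) (invSqrt_nonneg _))
  exact (Real.continuous_arcsin.comp (by fun_prop)).continuousOn

lemma indicator_invSqrt_mul_invSqrt (τ : ℝ) :
    (Ioc 0 τ).indicator (fun s => invSqrt s * invSqrt (τ - s)) =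
      fun s => invSqrt s * invSqrt (τ - s) := by
  ext s
  by_cases h0 : 0 < s
  · by_cases hb : s ≤ τ
    · simp [indicator, h0, hb]
    · simp [indicator, h0, hb, invSqrt_of_nonpos (by linarith : τ - s ≤ 0)]
  · simp [indicator, h0, invSqrt_of_nonpos (not_lt.1 h0)]

lemma integrable_invSqrt_mul_invSqrt (τ : ℝ) :
    Integrable (fun s => invSqrt s * invSqrt (τ - s)) := by
  rw [← indicator_invSqrt_mul_invSqrt, integrable_indicator_iff measurableSet_Ioc]
  exact integrableOn_invSqrt_mul_invSqrt τ

/-- Half-order integration applied twice is integration: `s₊^(-1/2)` convolved with itself is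
`π` times the Heaviside function. -/
lemma integral_invSqrt_mul_invSqrt (τ : ℝ) :
    ∫ s, invSqrt s * invSqrt (τ - s) = (Ioi 0).indicator (fun _ => Real.pi) τ := by
  rw [← indicator_invSqrt_mul_invSqrt, integral_indicator measurableSet_Ioc]
  by_cases hτ : 0 < τ
  · rw [← intervalIntegral.integral_of_le hτ.le,
      intervalIntegral.integral_eq_sub_of_hasDerivAt_of_le hτ.le
        (f := fun x => Real.arcsin (2 * x / τ - 1))
        (Real.continuous_arcsin.comp (by fun_prop)).continuousOn
        (fun x hx => hasDerivAt_arcsin_affine hx)]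
    · have h : 2 * τ / τ - 1 = 1 := by field_simp; norm_num
      simp only [h, indicator, mem_Ioi, hτ, if_true]
      simp
    · rw [intervalIntegrable_iff_integrableOn_Ioc_of_le hτ.le]
      exact integrableOn_invSqrt_mul_invSqrt τ
  · simp [hτ, Ioc_eq_empty]

/-- The kernel `s₊^(-1/2) - (s - h)₊^(-1/2)`; convolved with `s₊^(-1/2)` it gives `π` times the
indicator of `(0, h]`. -/
noncomputable def diffKernel (h s : ℝ) : ℝ := invSqrt s - invSqrt (s - h)

lemma diffKernel_of_nonpos {h s : ℝ} (hh : 0 ≤ h) (hs : s ≤ 0) : diffKernel h s = 0 := by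
  simp [diffKernel, invSqrt_of_nonpos hs, invSqrt_of_nonpos (by linarith : s - h ≤ 0)]

lemma invSqrt_anti {s t : ℝ} (hs : 0 < s) (hst : s ≤ t) : invSqrt t ≤ invSqrt s :=
  inv_anti₀ (Real.sqrt_pos.2 hs) (Real.sqrt_le_sqrt hst)

lemma abs_diffKernel {h : ℝ} (hh : 0 ≤ h) (s : ℝ) :
    |diffKernel h s| = invSqrt (s - h) - invSqrt s + 2 * (Iic h).indicator invSqrt s := by
  unfold diffKernel
  by_cases hs : s ≤ h
  · rw [indicator_of_mem (show s ∈ Iic h from hs), invSqrt_of_nonpos (by linarith : s - h ≤ 0),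
      sub_zero, abs_of_nonneg (invSqrt_nonneg s)]
    ring
  · rw [indicator_of_notMem (show s ∉ Iic h from hs),
      abs_of_nonpos (sub_nonpos.2 (invSqrt_anti (by linarith) (by linarith)))]
    ring

lemma integrableOn_invSqrt_sub (h b : ℝ) : IntegrableOn (fun s => invSqrt (s - h)) (Iic b) := by
  have := (integrable_indicator_iff measurableSet_Iic).2 (integrableOn_invSqrt_Iic (b - h))
  have h2 := this.comp_sub_right h
  rw [← integrable_indicator_iff measurableSet_Iic]
  refine h2.congr (Filter.Eventually.of_forall fun s => ?_)
  simp [indicator]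

lemma integral_invSqrt_sub {h b : ℝ} (hb : h ≤ b) :
    ∫ s in Iic b, invSqrt (s - h) = 2 * Real.sqrt (b - h) := by
  rw [← integral_invSqrt_Iic (sub_nonneg.2 hb), ← integral_indicator measurableSet_Iic,
    ← integral_indicator measurableSet_Iic,
    ← integral_sub_right_eq_self ((Iic (b - h)).indicator invSqrt) h]
  congr 1
  ext s
  simp [indicator]

lemma integrableOn_diffKernel (h b : ℝ) : IntegrableOn (diffKernel h) (Iic b) :=
  (integrableOn_invSqrt_Iic b).sub (integrableOn_invSqrt_sub h b)

lemma integral_abs_diffKernel_le {h : ℝ} (h0 : 0 ≤ h) (h1 : h ≤ 1) :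
    ∫ s in Iic 1, |diffKernel h s| ≤ 4 * Real.sqrt h := by
  simp_rw [abs_diffKernel h0]
  have hi : IntegrableOn ((Iic h).indicator invSqrt) (Iic 1) :=
    ((integrable_indicator_iff measurableSet_Iic).2 (integrableOn_invSqrt_Iic h)).integrableOn
  have e : ∫ s in Iic 1, (Iic h).indicator invSqrt s = 2 * Real.sqrt h := by
    rw [setIntegral_indicator measurableSet_Iic, Iic_inter_Iic, min_eq_right h1,
      integral_invSqrt_Iic h0]
  have hs : IntegrableOn (fun s => invSqrt (s - h) - invSqrt s) (Iic 1) :=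
    (integrableOn_invSqrt_sub h 1).sub (integrableOn_invSqrt_Iic 1)
  rw [integral_add hs (hi.const_mul 2),
    integral_sub (integrableOn_invSqrt_sub h 1) (integrableOn_invSqrt_Iic 1),
    integral_const_mul, e, integral_invSqrt_sub h1, integral_invSqrt_Iic zero_le_one]
  have : Real.sqrt (1 - h) ≤ 1 := Real.sqrt_le_one.2 (by linarith)
  rw [Real.sqrt_one]
  linarith

/-! ### Half-order integration on the line -/

/-- The half-order integral `y ↦ ∫ s₊^(-1/2) f (y + s) ds`. In the variable `y = x²` it is the Abel
transform. -/
noncomputable def halfIntegral (f : ℝ → ℝ) (y : ℝ) : ℝ := ∫ s, invSqrt s * f (y + s)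

variable {f : ℝ → ℝ} {m : ℝ}

lemma integrable_invSqrt_mul (hf : Measurable f) (hm : ∀ t, |f t| ≤ m)
    (h1 : ∀ t, 1 ≤ t → f t = 0) (y : ℝ) : Integrable (fun s => invSqrt s * f (y + s)) := by
  have hi := (integrable_indicator_iff measurableSet_Iic).2 (integrableOn_invSqrt_Iic (1 - y))
  refine (hi.mul_const m).mono'
    (measurable_invSqrt.mul (hf.comp (measurable_const_add y))).aestronglyMeasurable
    (Filter.Eventually.of_forall fun s => ?_)
  by_cases hs : s ≤ 1 - y
  · rw [indicator_of_mem (show s ∈ Iic (1 - y) from hs), Real.norm_eq_abs, abs_mul,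
      abs_of_nonneg (invSqrt_nonneg s)]
    exact mul_le_mul_of_nonneg_left (hm _) (invSqrt_nonneg s)
  · rw [h1 _ (by linarith), indicator_of_notMem (show s ∉ Iic (1 - y) from hs)]
    simp

lemma halfIntegral_of_one_le (h1 : ∀ t, 1 ≤ t → f t = 0) {y : ℝ} (hy : 1 ≤ y) :
    halfIntegral f y = 0 := by
  unfold halfIntegral
  rw [integral_eq_zero_of_ae]
  refine Filter.Eventually.of_forall fun s => ?_
  by_cases hs : s ≤ 0
  · simp [invSqrt_of_nonpos hs]
  · simp [h1 (y + s) (by linarith)]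

lemma abs_halfIntegral_le (hm : ∀ t, |f t| ≤ m) (h1 : ∀ t, 1 ≤ t → f t = 0)
    {y : ℝ} (hy : 0 ≤ y) : |halfIntegral f y| ≤ 2 * m := by
  have hm0 : 0 ≤ m := (abs_nonneg _).trans (hm 0)
  have hi := (integrable_indicator_iff measurableSet_Iic).2 (integrableOn_invSqrt_Iic 1)
  have : |halfIntegral f y| ≤ ∫ s, (Iic 1).indicator invSqrt s * m := by
    refine norm_integral_le_of_norm_le (f := fun s => invSqrt s * f (y + s)) (hi.mul_const m)
      (Filter.Eventually.of_forall fun s => ?_)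
    by_cases hs : s ≤ 1
    · rw [indicator_of_mem (show s ∈ Iic (1 : ℝ) from hs), Real.norm_eq_abs, abs_mul,
        abs_of_nonneg (invSqrt_nonneg s)]
      exact mul_le_mul_of_nonneg_left (hm _) (invSqrt_nonneg s)
    · rw [h1 _ (by linarith), indicator_of_notMem (show s ∉ Iic (1 : ℝ) from hs)]
      simp
  rwa [integral_mul_const, integral_indicator measurableSet_Iic, integral_invSqrt_Iic zero_le_one,
    Real.sqrt_one, mul_one] at this

/-- The integrand of the twofold half-order integral is absolutely integrable, which permits Fubini's
theorem in `integral_invSqrt_mul_halfIntegral`. -/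
lemma integrable_half_half (hf : Measurable f) (hm : ∀ t, |f t| ≤ m)
    (h1 : ∀ t, 1 ≤ t → f t = 0) (t : ℝ) :
    Integrable (fun p : ℝ × ℝ => invSqrt p.1 * invSqrt (p.2 - p.1) * f (t + p.2))
      (volume.prod volume) := by
  have hmeas : Measurable (fun p : ℝ × ℝ => invSqrt p.1 * invSqrt (p.2 - p.1) * f (t + p.2)) :=
    ((measurable_invSqrt.comp measurable_fst).mul
      (measurable_invSqrt.comp (measurable_snd.sub measurable_fst))).mul
      (hf.comp (measurable_const.add measurable_snd))
  rw [integrable_prod_iff' hmeas.aestronglyMeasurable]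
  refine ⟨Filter.Eventually.of_forall fun τ =>
    (integrable_invSqrt_mul_invSqrt τ).mul_const (f (t + τ)), ?_⟩
  have e : ∀ τ, ∫ s, ‖invSqrt s * invSqrt (τ - s) * f (t + τ)‖ =
      (Ioi 0).indicator (fun _ => Real.pi) τ * |f (t + τ)| := fun τ => by
    rw [← integral_invSqrt_mul_invSqrt, ← integral_mul_const]
    congr 1
    ext s
    rw [Real.norm_eq_abs, abs_mul,
      abs_of_nonneg (mul_nonneg (invSqrt_nonneg _) (invSqrt_nonneg _))]
  simp_rw [e]
  have hc : Integrable ((Ioc 0 (1 - t)).indicator fun _ : ℝ => Real.pi * m) :=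
    (integrable_indicator_iff measurableSet_Ioc).2 (integrableOn_const (by simp))
  refine hc.mono' (((measurable_const.indicator measurableSet_Ioi).mul
    (hf.comp (measurable_const_add t)).abs).aestronglyMeasurable)
    (Filter.Eventually.of_forall fun τ => ?_)
  by_cases h0 : 0 < τ
  · by_cases hτ : τ ≤ 1 - t
    · rw [indicator_of_mem (show τ ∈ Ioi (0 : ℝ) from h0),
        indicator_of_mem (show τ ∈ Ioc 0 (1 - t) from ⟨h0, hτ⟩), Real.norm_eq_abs, abs_mul,
        abs_abs, abs_of_pos Real.pi_pos]
      exact mul_le_mul_of_nonneg_left (hm _) Real.pi_pos.le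
    · rw [h1 _ (by linarith),
        indicator_of_notMem (show τ ∉ Ioc 0 (1 - t) from fun h => hτ h.2)]
      simp
  · rw [indicator_of_notMem (show τ ∉ Ioi (0 : ℝ) from h0), indicator_of_notMem (fun h => h0 h.1)]
    simp

lemma integral_half_half_inner (s t : ℝ) :
    ∫ τ, invSqrt s * invSqrt (τ - s) * f (t + τ) = invSqrt s * halfIntegral f (t + s) := by
  simp_rw [mul_assoc]
  rw [integral_const_mul, halfIntegral,
    ← integral_sub_right_eq_self (fun σ => invSqrt σ * f (t + s + σ)) s]
  congr 3
  ext τ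
  ring_nf

lemma integrable_invSqrt_mul_halfIntegral (hf : Measurable f) (hm : ∀ t, |f t| ≤ m)
    (h1 : ∀ t, 1 ≤ t → f t = 0) (t : ℝ) :
    Integrable (fun s => invSqrt s * halfIntegral f (t + s)) := by
  simp_rw [← integral_half_half_inner]
  exact (integrable_half_half hf hm h1 t).integral_prod_left

lemma integral_invSqrt_mul_halfIntegral (hf : Measurable f) (hm : ∀ t, |f t| ≤ m)
    (h1 : ∀ t, 1 ≤ t → f t = 0) (t : ℝ) :
    ∫ s, invSqrt s * halfIntegral f (t + s) = Real.pi * ∫ τ in Ioi t, f τ := by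
  simp_rw [← integral_half_half_inner]
  rw [integral_integral_swap (integrable_half_half hf hm h1 t)]
  simp_rw [integral_mul_const, integral_invSqrt_mul_invSqrt]
  rw [← integral_const_mul, ← integral_indicator measurableSet_Ioi,
    ← integral_add_left_eq_self ((Ioi t).indicator fun τ => Real.pi * f τ) t]
  congr 1
  ext τ
  simp [indicator]

lemma integrableOn_Ioc_of_abs_le (hf : Measurable f) (hm : ∀ t, |f t| ≤ m) (a b : ℝ) :
    IntegrableOn f (Ioc a b) :=
  Measure.integrableOn_of_bounded (by simp) hf.aestronglyMeasurable
    (Filter.Eventually.of_forall hm)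

/-- The local averages of `f` are recovered from its half-order integral by an absolutely convergent
integral. -/
lemma integral_diffKernel_mul_halfIntegral (hf : Measurable f) (hm : ∀ t, |f t| ≤ m)
    (h1 : ∀ t, 1 ≤ t → f t = 0) {t h : ℝ} (ht : 0 ≤ t) (hh : 0 ≤ h) :
    ∫ s in Iic 1, diffKernel h s * halfIntegral f (t + s) = Real.pi * ∫ s in Ioc 0 h, f (t + s) := by
  have hi := integrable_invSqrt_mul_halfIntegral hf hm h1
  have e2 : ∀ s, invSqrt (s - h) * halfIntegral f (t + s) =
      (fun s => invSqrt s * halfIntegral f (t + h + s)) (s - h) := fun s => by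
    ring_nf
  have hfi : ∀ a, IntegrableOn f (Ioi a) := fun a => by
    have : Integrable ((Ioc a 1).indicator f) :=
      (integrable_indicator_iff measurableSet_Ioc).2 (integrableOn_Ioc_of_abs_le hf hm a 1)
    refine this.integrableOn.congr_fun (s := Ioi a) (fun s hs => ?_) measurableSet_Ioi
    by_cases h : s ≤ 1
    · rw [indicator_of_mem (show s ∈ Ioc a 1 from ⟨hs, h⟩)]
    · rw [indicator_of_notMem (fun h' => h h'.2), h1 s (by linarith)]
  calc ∫ s in Iic 1, diffKernel h s * halfIntegral f (t + s)
      = ∫ s, diffKernel h s * halfIntegral f (t + s) := by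
        refine setIntegral_eq_integral_of_forall_compl_eq_zero fun s hs => ?_
        rw [halfIntegral_of_one_le h1 (by simp at hs; linarith), mul_zero]
    _ = Real.pi * ((∫ τ in Ioi t, f τ) - ∫ τ in Ioi (t + h), f τ) := by
        unfold diffKernel
        simp_rw [sub_mul, e2]
        rw [integral_sub (hi t) ((hi (t + h)).comp_sub_right h),
          integral_sub_right_eq_self (fun s => invSqrt s * halfIntegral f (t + h + s)),
          integral_invSqrt_mul_halfIntegral hf hm h1, integral_invSqrt_mul_halfIntegral hf hm h1]
        ring
    _ = _ := by
        congr 1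
        rw [← Ioc_union_Ioi_eq_Ioi (by linarith : t ≤ t + h),
          setIntegral_union (Ioc_disjoint_Ioi le_rfl) measurableSet_Ioi
            (integrableOn_Ioc_of_abs_le hf hm _ _) (hfi _), add_sub_cancel_right,
          ← integral_indicator measurableSet_Ioc, ← integral_indicator measurableSet_Ioc,
          ← integral_add_left_eq_self ((Ioc t (t + h)).indicator f) t]
        congr 1
        ext s
        simp [indicator]

end AbelTV

namespace AbelTV

/-! ### Correlations along the first coordinate -/

lemma shift_eq_add (s : ℝ) :
    (fun p : ℝ × ℝ => (p.1 + s, p.2)) = fun p => p + (s, 0) := by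
  ext p <;> simp

lemma measurePreserving_shift (s : ℝ) :
    MeasurePreserving (fun p : ℝ × ℝ => (p.1 + s, p.2)) volume volume := by
  rw [shift_eq_add]
  exact measurePreserving_add_right _ _

lemma measurableEmbedding_shift (s : ℝ) :
    MeasurableEmbedding (fun p : ℝ × ℝ => (p.1 + s, p.2)) := by
  rw [shift_eq_add]
  exact measurableEmbedding_addRight _

lemma integral_comp_shift (F : ℝ × ℝ → ℝ) (s : ℝ) :
    ∫ p : ℝ × ℝ, F (p.1 + s, p.2) = ∫ p, F p :=
  (measurePreserving_shift s).integral_comp (measurableEmbedding_shift s) F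

section Correlation

variable {f g : ℝ × ℝ → ℝ} {k a : ℝ → ℝ} {S : Set ℝ} {M : ℝ}

lemma integrable_correlation (hf : Integrable f) (hk : IntegrableOn k S) (ha : Measurable a)
    (hg : Measurable g) (hM : ∀ p, |g p| ≤ M) :
    Integrable (fun q : (ℝ × ℝ) × ℝ => f q.1 * (k q.2 * g (q.1.1 + a q.2, q.1.2)))
      (volume.prod (volume.restrict S)) := by
  have h := Integrable.mul_prod hf hk
  have hgm : Measurable fun q : (ℝ × ℝ) × ℝ => g (q.1.1 + a q.2, q.1.2) :=
    hg.comp ((measurable_fst.fst.add (ha.comp measurable_snd)).prodMk measurable_fst.snd)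
  have h2 := h.bdd_mul hgm.aestronglyMeasurable (Filter.Eventually.of_forall fun q => hM _)
  refine h2.congr (Filter.Eventually.of_forall fun q => ?_)
  simp only
  ring

lemma integral_correlation_swap (hf : Integrable f) (hk : IntegrableOn k S) (ha : Measurable a)
    (hg : Measurable g) (hM : ∀ p, |g p| ≤ M) :
    ∫ p, f p * ∫ s in S, k s * g (p.1 + a s, p.2) =
      ∫ s in S, k s * ∫ p, f p * g (p.1 + a s, p.2) := by
  have h := integral_integral_swap
    (f := fun (p : ℝ × ℝ) s => f p * (k s * g (p.1 + a s, p.2)))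
    (integrable_correlation hf hk ha hg hM)
  simp_rw [integral_const_mul] at h
  rw [h]
  congr 1
  ext s
  rw [← integral_const_mul]
  congr 1
  ext p
  ring

lemma integrable_mul_correlation (hf : Integrable f) (hk : IntegrableOn k S) (ha : Measurable a)
    (hg : Measurable g) (hM : ∀ p, |g p| ≤ M) :
    Integrable (fun p => f p * ∫ s in S, k s * g (p.1 + a s, p.2)) := by
  simp_rw [← integral_const_mul]
  exact (integrable_correlation hf hk ha hg hM).integral_prod_left

lemma abs_integral_mul_shift_le (hf : Integrable fun p => f p ^ 2)
    (hg : Integrable fun p => g p ^ 2) {l : ℝ} (hl : 0 < l) (s : ℝ) :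
    |∫ p, f p * g (p.1 + s, p.2)| ≤ (l * (∫ p, f p ^ 2) + l⁻¹ * ∫ p, g p ^ 2) / 2 := by
  have hg' : Integrable fun p : ℝ × ℝ => g (p.1 + s, p.2) ^ 2 :=
    (measurePreserving_shift s).integrable_comp_of_integrable hg
  have e := integral_comp_shift (fun p => g p ^ 2) s
  rw [← e, ← integral_const_mul, ← integral_const_mul,
    ← integral_add (hf.const_mul l) (hg'.const_mul _), ← integral_div]
  refine norm_integral_le_of_norm_le (f := fun p : ℝ × ℝ => f p * g (p.1 + s, p.2))
    (((hf.const_mul l).add (hg'.const_mul _)).div_const 2)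
    (Filter.Eventually.of_forall fun p => ?_)
  rw [Real.norm_eq_abs, abs_mul]
  -- Young's inequality `2 |x y| ≤ l x² + y² / l`
  have h1 : 0 ≤ l⁻¹ * (l * |f p| - |g (p.1 + s, p.2)|) ^ 2 := by positivity
  have h2 : l⁻¹ * (l * |f p| - |g (p.1 + s, p.2)|) ^ 2 =
      l * f p ^ 2 + l⁻¹ * g (p.1 + s, p.2) ^ 2 - 2 * (|f p| * |g (p.1 + s, p.2)|) := by
    rw [← sq_abs (f p), ← sq_abs (g (p.1 + s, p.2))]
    field_simp
    ring
  rw [h2] at h1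
  linarith

/-- Young's inequality for `⟨f, k ∗ g⟩`, in the form with a free weight `l`. -/
lemma integral_mul_correlation_le (hf : Integrable f) (hf2 : Integrable fun p => f p ^ 2)
    (hk : IntegrableOn k S) (hg : Measurable g) (hM : ∀ p, |g p| ≤ M)
    (hg2 : Integrable fun p => g p ^ 2) {l : ℝ} (hl : 0 < l) :
    ∫ p, f p * ∫ s in S, k s * g (p.1 + s, p.2) ≤
      (∫ s in S, |k s|) * ((l * (∫ p, f p ^ 2) + l⁻¹ * ∫ p, g p ^ 2) / 2) := by
  rw [integral_correlation_swap hf hk measurable_id' hg hM, ← integral_mul_const]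
  refine (le_abs_self _).trans (norm_integral_le_of_norm_le
    (f := fun s => k s * ∫ p : ℝ × ℝ, f p * g (p.1 + s, p.2)) (hk.abs.mul_const _)
    (Filter.Eventually.of_forall fun s => ?_))
  rw [Real.norm_eq_abs, abs_mul]
  exact mul_le_mul_of_nonneg_left (abs_integral_mul_shift_le hf2 hg2 hl s) (abs_nonneg _)

end Correlation

/-! ### Profiles in the squared radius -/

/-- Measurable functions of `(t, z)`, where `t = r²`, that are bounded by `m` and vanish outside
`(0,1) × [-1,1]`. -/
structure IsProfile (m : ℝ) (w : ℝ × ℝ → ℝ) : Prop where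
  measurable : Measurable w
  abs_le : ∀ p, |w p| ≤ m
  eq_zero : ∀ p, p ∉ Ioo (0 : ℝ) 1 ×ˢ Icc (-1 : ℝ) 1 → w p = 0

/-- A bounded measurable function that vanishes off a set of finite measure is integrable. -/
lemma integrable_of_abs_le_of_eq_zero {f : ℝ × ℝ → ℝ} {m : ℝ} {K : Set (ℝ × ℝ)}
    (hf : AEStronglyMeasurable f) (hm : ∀ p, |f p| ≤ m) (hKm : MeasurableSet K)
    (hK : volume K ≠ ∞) (h0 : ∀ p, p ∉ K → f p = 0) : Integrable f := by
  have h : IntegrableOn f K := Measure.integrableOn_of_bounded hK hf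
    (Filter.Eventually.of_forall hm)
  have h2 := (integrable_indicator_iff hKm).2 h
  refine h2.congr (Filter.Eventually.of_forall fun p => ?_)
  by_cases hp : p ∈ K
  · simp [hp]
  · simp [hp, h0 p hp]

lemma volume_profile_ne_top : volume (Ioo (0 : ℝ) 1 ×ˢ Icc (-1 : ℝ) 1) ≠ ∞ := by
  rw [Measure.volume_eq_prod, Measure.prod_prod]
  exact ENNReal.mul_ne_top (by simp) (by simp)

lemma measurableSet_profile : MeasurableSet (Ioo (0 : ℝ) 1 ×ˢ Icc (-1 : ℝ) 1) :=
  measurableSet_Ioo.prod measurableSet_Icc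

/-- The mean of `w` over the segment of length `h` to the right of a point. -/
noncomputable def segmentMean (h : ℝ) (w : ℝ × ℝ → ℝ) (p : ℝ × ℝ) : ℝ :=
  h⁻¹ * ∫ s in Ioc 0 h, w (p.1 + s, p.2)

/-- The open right half plane. -/
def rightHalf : Set (ℝ × ℝ) := Ioi (0 : ℝ) ×ˢ univ

lemma measurableSet_rightHalf : MeasurableSet rightHalf := measurableSet_Ioi.prod MeasurableSet.univ

/-- The half-order integral of `w` in its first variable, restricted to positive values of it. -/
noncomputable def halfTransform (w : ℝ × ℝ → ℝ) : ℝ × ℝ → ℝ :=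
  rightHalf.indicator fun p => halfIntegral (fun t => w (t, p.2)) p.1

namespace IsProfile

variable {m : ℝ} {w : ℝ × ℝ → ℝ}

lemma nonneg (hw : IsProfile m w) : 0 ≤ m := (abs_nonneg _).trans (hw.abs_le 0)

lemma integrable (hw : IsProfile m w) : Integrable w :=
  integrable_of_abs_le_of_eq_zero hw.measurable.aestronglyMeasurable hw.abs_le
    measurableSet_profile volume_profile_ne_top hw.eq_zero

lemma integrable_sq (hw : IsProfile m w) : Integrable fun p => w p ^ 2 := by
  have := hw.integrable.bdd_mul hw.measurable.aestronglyMeasurable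
    (Filter.Eventually.of_forall hw.abs_le)
  simpa only [sq] using this

lemma measurable_slice (hw : IsProfile m w) (z : ℝ) : Measurable fun t => w (t, z) :=
  hw.measurable.comp measurable_prodMk_right

lemma slice_eq_zero (hw : IsProfile m w) (z : ℝ) (t : ℝ) (ht : 1 ≤ t) : w (t, z) = 0 :=
  hw.eq_zero _ fun h => absurd h.1.2 (not_lt.2 ht)

lemma slice_eq_zero_of_nonpos (hw : IsProfile m w) (z : ℝ) (t : ℝ) (ht : t ≤ 0) : w (t, z) = 0 :=
  hw.eq_zero _ fun h => absurd h.1.1 (not_lt.2 ht)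

lemma measurable_halfIntegral (hw : IsProfile m w) :
    Measurable fun p : ℝ × ℝ => halfIntegral (fun t => w (t, p.2)) p.1 := by
  unfold halfIntegral
  refine (StronglyMeasurable.integral_prod_right (ν := volume)
    (f := fun (p : ℝ × ℝ) s => invSqrt s * w (p.1 + s, p.2)) ?_).measurable
  refine Measurable.stronglyMeasurable ?_
  exact (measurable_invSqrt.comp measurable_snd).mul (hw.measurable.comp
    ((measurable_fst.fst.add measurable_snd).prodMk measurable_fst.snd))

lemma measurable_halfTransform (hw : IsProfile m w) : Measurable (halfTransform w) :=
  hw.measurable_halfIntegral.indicator measurableSet_rightHalf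

lemma halfTransform_eq_zero (hw : IsProfile m w) (p : ℝ × ℝ)
    (hp : p ∉ Ioo (0 : ℝ) 1 ×ˢ Icc (-1 : ℝ) 1) : halfTransform w p = 0 := by
  by_cases h0 : 0 < p.1
  · rw [halfTransform, indicator_of_mem (show p ∈ rightHalf from ⟨h0, trivial⟩)]
    by_cases h1 : p.1 < 1
    · have hz : ∀ t, w (t, p.2) = 0 := fun t => hw.eq_zero _ fun h => hp ⟨⟨h0, h1⟩, h.2⟩
      simp [halfIntegral, hz]
    · exact halfIntegral_of_one_le (hw.slice_eq_zero p.2) (not_lt.1 h1)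
  · exact indicator_of_notMem (fun h => h0 h.1) _

lemma abs_halfTransform_le (hw : IsProfile m w) (p : ℝ × ℝ) : |halfTransform w p| ≤ 2 * m := by
  by_cases h0 : 0 < p.1
  · rw [halfTransform, indicator_of_mem (show p ∈ rightHalf from ⟨h0, trivial⟩)]
    exact abs_halfIntegral_le (fun t => hw.abs_le _) (hw.slice_eq_zero p.2) h0.le
  · rw [halfTransform, indicator_of_notMem (fun h => h0 h.1), abs_zero]
    linarith [hw.nonneg]

lemma halfTransform_isProfile (hw : IsProfile m w) : IsProfile (2 * m) (halfTransform w) :=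
  ⟨hw.measurable_halfTransform, hw.abs_halfTransform_le, hw.halfTransform_eq_zero⟩

/-- The pairing of `w` with its local means is controlled by the half-order integral: the means are
`(π h)⁻¹ (diffKernel h) ∗ (halfTransform w)`, and the kernel has `L¹` norm at most `4 √h`. -/
lemma integral_mul_segmentMean_le (hw : IsProfile m w) {h : ℝ} (h0 : 0 < h) (h1 : h ≤ 1) :
    ∫ p, w p * segmentMean h w p ≤
      (∫ p, w p ^ 2) / 2 + h⁻¹ * ∫ p, halfTransform w p ^ 2 := by
  have hG := hw.halfTransform_isProfile
  have e : ∀ p, w p * segmentMean h w p = (Real.pi * h)⁻¹ *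
      (w p * ∫ s in Iic 1, diffKernel h s * halfTransform w (p.1 + s, p.2)) := fun p => by
    by_cases hp : 0 < p.1
    · have h2 := integral_diffKernel_mul_halfIntegral (hw.measurable_slice p.2)
        (fun t => hw.abs_le _) (hw.slice_eq_zero p.2) hp.le h0.le
      have h3 : ∀ s, diffKernel h s * halfTransform w (p.1 + s, p.2) =
          diffKernel h s * halfIntegral (fun t => w (t, p.2)) (p.1 + s) := fun s => by
        by_cases hs : s ≤ 0
        · simp [diffKernel_of_nonpos h0.le hs]
        · rw [halfTransform, indicator_of_mem]
          exact ⟨show 0 < p.1 + s by linarith, trivial⟩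
      simp_rw [h3]
      rw [h2, segmentMean]
      have := Real.pi_pos
      field_simp
    · have : w p = 0 := hw.slice_eq_zero_of_nonpos p.2 p.1 (not_lt.1 hp)
      simp [this]
  simp_rw [e]
  rw [integral_const_mul]
  have hs : 0 < Real.sqrt h := Real.sqrt_pos.2 h0
  have hsq : Real.sqrt h ^ 2 = h := Real.sq_sqrt h0.le
  -- the weight for which the first term below becomes half of `∫ w²`
  have hl : 0 < Real.pi * Real.sqrt h / 4 := by have := Real.pi_pos; positivity
  have key := integral_mul_correlation_le hw.integrable hw.integrable_sq
    (integrableOn_diffKernel h 1) hG.measurable hG.abs_le hG.integrable_sq hl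
  set A := ∫ p, w p ^ 2
  set B := ∫ p, halfTransform w p ^ 2 with hB
  have hA0 : 0 ≤ A := integral_nonneg fun p => sq_nonneg _
  have hB0 : 0 ≤ B := integral_nonneg fun p => sq_nonneg _
  have hpi := Real.pi_gt_three
  have key2 := key.trans (mul_le_mul_of_nonneg_right
    (integral_abs_diffKernel_le h0.le h1) (by positivity))
  calc (Real.pi * h)⁻¹ *
        ∫ p, w p * ∫ s in Iic 1, diffKernel h s * halfTransform w (p.1 + s, p.2)
      ≤ (Real.pi * h)⁻¹ * (4 * Real.sqrt h * ((Real.pi * Real.sqrt h / 4 * A +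
          (Real.pi * Real.sqrt h / 4)⁻¹ * B) / 2)) :=
        mul_le_mul_of_nonneg_left key2 (by positivity)
    _ = A / 2 + 8 / Real.pi ^ 2 * (h⁻¹ * B) := by
        have : ∀ x : ℝ, 0 < x → (Real.pi * x ^ 2)⁻¹ * (4 * x * ((Real.pi * x / 4 * A +
            (Real.pi * x / 4)⁻¹ * B) / 2)) = A / 2 + 8 / Real.pi ^ 2 * ((x ^ 2)⁻¹ * B) :=
          fun x hx => by
            have := Real.pi_pos
            field_simp
            ring
        simpa only [hsq] using this (Real.sqrt h) hs
    _ ≤ A / 2 + 1 * (h⁻¹ * B) := by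
        gcongr
        rw [div_le_one (by positivity)]
        nlinarith
    _ = A / 2 + h⁻¹ * B := by ring

/-- For `h = 2` at least half of every segment that starts in the support of `w` lies outside it, which
makes up for the lack of smallness of `h`. -/
lemma integral_mul_segmentMean_two_le (hw : IsProfile m w) :
    ∫ p, w p * segmentMean 2 w p ≤ (∫ p, w p ^ 2) / 2 := by
  have e : ∀ p, w p * segmentMean 2 w p =
      w p * ∫ s in Ioc 0 1, (1 / 2 : ℝ) * w (p.1 + s, p.2) := fun p => by
    by_cases hp : 0 < p.1
    · rw [integral_const_mul, segmentMean]
      congr 1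
      rw [inv_eq_one_div]
      congr 1
      -- the first coordinate exceeds `1` on the second half of the segment
      refine setIntegral_eq_of_subset_of_forall_sdiff_eq_zero measurableSet_Ioc
        (Ioc_subset_Ioc_right (by norm_num)) fun s hs => hw.slice_eq_zero _ _ ?_
      have : 1 < s := by
        by_contra h
        exact hs.2 ⟨hs.1.1, not_lt.1 h⟩
      linarith
    · have : w p = 0 := hw.slice_eq_zero_of_nonpos p.2 p.1 (not_lt.1 hp)
      simp [this]
  simp_rw [e]
  have key := integral_mul_correlation_le (k := fun _ => (1 / 2 : ℝ)) (S := Ioc 0 1)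
    hw.integrable hw.integrable_sq (integrableOn_const (by simp)) hw.measurable hw.abs_le
    hw.integrable_sq one_pos
  refine key.trans (le_of_eq ?_)
  have : ∫ s in Ioc (0 : ℝ) 1, |(1 / 2 : ℝ)| = 1 / 2 := by simp
  rw [this]
  ring

end IsProfile

end AbelTV

namespace AbelTV

/-! ### Variation in the first coordinate -/

/-- The open set `(0, ∞) × (-1, 1)`. -/
def halfStrip : Set (ℝ × ℝ) := Ioi (0 : ℝ) ×ˢ Ioo (-1 : ℝ) 1

/-- The variation of `w` in the first coordinate over the half strip is at most `C`, expressed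
through test functions of supremum at most `B`. -/
def FstVariationLE (C : ℝ) (w : ℝ × ℝ → ℝ) : Prop :=
  ∀ Φ : ℝ × ℝ → ℝ, ContDiff ℝ 1 Φ → HasCompactSupport Φ → tsupport Φ ⊆ halfStrip →
    ∀ B, (∀ p, |Φ p| ≤ B) → ∫ p, w p * fderiv ℝ Φ p (1, 0) ≤ C * B

/-- The function `∫₀ʰ (1 - s/h) ψ (t - s, z) ds`. Its derivative in `t` is `ψ` minus the mean of `ψ`
over the segment of length `h` to the left. -/
noncomputable def tentIntegral (h : ℝ) (ψ : ℝ × ℝ → ℝ) (p : ℝ × ℝ) : ℝ :=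
  ∫ s in (0 : ℝ)..h, (1 - s / h) * ψ (p.1 - s, p.2)

section Tent

variable {ψ : ℝ × ℝ → ℝ} {h : ℝ}

lemma hasFDerivAt_comp_shift (hψ : ContDiff ℝ 1 ψ) (s : ℝ) (p : ℝ × ℝ) :
    HasFDerivAt (fun p : ℝ × ℝ => ψ (p.1 - s, p.2)) (fderiv ℝ ψ (p.1 - s, p.2)) p := by
  have e : (fun p : ℝ × ℝ => ψ (p.1 - s, p.2)) = fun p => ψ (p - (s, 0)) := by
    ext p
    congr 1
    ext <;> simp
  have e2 : ((p.1 - s, p.2) : ℝ × ℝ) = p - (s, 0) := by ext <;> simp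
  rw [e, e2, hasFDerivAt_comp_sub]
  exact (hψ.differentiable (by simp) _).hasFDerivAt

lemma continuous_fderiv_comp_sub (hψ : ContDiff ℝ 1 ψ) :
    Continuous (Function.uncurry fun (p : ℝ × ℝ) (s : ℝ) =>
      (1 - s / h) • fderiv ℝ ψ (p.1 - s, p.2)) := by
  have := hψ.continuous_fderiv (by simp)
  unfold Function.uncurry
  fun_prop

lemma hasFDerivAt_tentIntegral (hψ : ContDiff ℝ 1 ψ) (hc : HasCompactSupport ψ) (p : ℝ × ℝ) :
    HasFDerivAt (tentIntegral h ψ)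
      (∫ s in (0 : ℝ)..h, (1 - s / h) • fderiv ℝ ψ (p.1 - s, p.2)) p := by
  obtain ⟨D, hD⟩ := (hψ.continuous_fderiv (by simp)).bounded_above_of_compact_support
    (hc.fderiv (𝕜 := ℝ))
  have hcont := hψ.continuous
  have hcont' := hψ.continuous_fderiv (by simp)
  unfold tentIntegral
  refine intervalIntegral.hasFDerivAt_integral_of_dominated_of_fderiv_le (𝕜 := ℝ) (μ := volume)
    (F := fun (p : ℝ × ℝ) s => (1 - s / h) * ψ (p.1 - s, p.2))
    (F' := fun (p : ℝ × ℝ) s => (1 - s / h) • fderiv ℝ ψ (p.1 - s, p.2))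
    (bound := fun s => |1 - s / h| * D) Filter.univ_mem
    (Filter.Eventually.of_forall fun q => ?_) ?_ ?_ ?_ ?_ ?_
  · exact Continuous.aestronglyMeasurable (by fun_prop)
  · exact Continuous.intervalIntegrable (by fun_prop) _ _
  · exact Continuous.aestronglyMeasurable (by fun_prop)
  · refine Filter.Eventually.of_forall fun s _ q _ => ?_
    rw [norm_smul, Real.norm_eq_abs]
    exact mul_le_mul_of_nonneg_left (hD _) (abs_nonneg _)
  · exact Continuous.intervalIntegrable (by fun_prop) _ _
  · refine Filter.Eventually.of_forall fun s _ q _ => ?_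
    exact (hasFDerivAt_comp_shift hψ s q).const_mul (1 - s / h)

lemma contDiff_tentIntegral (hψ : ContDiff ℝ 1 ψ) (hc : HasCompactSupport ψ) :
    ContDiff ℝ 1 (tentIntegral h ψ) :=
  contDiff_one_iff_hasFDerivAt.2 ⟨_,
    intervalIntegral.continuous_parametric_intervalIntegral_of_continuous'
      (continuous_fderiv_comp_sub hψ) 0 h, hasFDerivAt_tentIntegral hψ hc⟩

lemma fderiv_tentIntegral (hh : h ≠ 0) (hψ : ContDiff ℝ 1 ψ) (hc : HasCompactSupport ψ)
    (p : ℝ × ℝ) :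
    fderiv ℝ (tentIntegral h ψ) p (1, 0) =
      ψ p - h⁻¹ * ∫ s in (0 : ℝ)..h, ψ (p.1 - s, p.2) := by
  have hcont := hψ.continuous
  have hcont' := hψ.continuous_fderiv (by simp)
  have hd : ∀ s, HasDerivAt (fun s => -((1 - s / h) * ψ (p.1 - s, p.2)))
      (h⁻¹ * ψ (p.1 - s, p.2) + (1 - s / h) * fderiv ℝ ψ (p.1 - s, p.2) (1, 0)) s := fun s => by
    have h1 : HasDerivAt (fun s : ℝ => ((p.1 - s, p.2) : ℝ × ℝ)) (-1, 0) s :=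
      ((hasDerivAt_id s).const_sub p.1).prodMk (hasDerivAt_const s p.2)
    have h2 := (hψ.differentiable (by simp) (p.1 - s, p.2)).hasFDerivAt.comp_hasDerivAt s h1
    have h3 : HasDerivAt (fun s : ℝ => 1 - s / h) (-h⁻¹) s := by
      simpa using ((hasDerivAt_id s).div_const h).const_sub 1
    have e : ((-1, 0) : ℝ × ℝ) = -(1, 0) := by simp
    convert! (h3.mul h2).neg using 1
    rw [e, map_neg]
    simp only [Function.comp]
    ring
  have hi1 : IntervalIntegrable (fun s => h⁻¹ * ψ (p.1 - s, p.2)) volume 0 h :=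
    Continuous.intervalIntegrable (by fun_prop) _ _
  have hi2 : IntervalIntegrable (fun s => (1 - s / h) * fderiv ℝ ψ (p.1 - s, p.2) (1, 0))
      volume 0 h := Continuous.intervalIntegrable (by fun_prop) _ _
  have hi3 : IntervalIntegrable (fun s => (1 - s / h) • fderiv ℝ ψ (p.1 - s, p.2))
      volume 0 h := Continuous.intervalIntegrable (by fun_prop) _ _
  have key := intervalIntegral.integral_eq_sub_of_hasDerivAt (fun s _ => hd s) (hi1.add hi2)
  rw [intervalIntegral.integral_add hi1 hi2, intervalIntegral.integral_const_mul] at key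
  rw [(hasFDerivAt_tentIntegral hψ hc p).fderiv, ContinuousLinearMap.intervalIntegral_apply hi3]
  simp only [FunLike.coe_smul, Pi.smul_apply, smul_eq_mul, div_self hh] at key ⊢
  simp at key
  linarith

lemma abs_tentIntegral_le (hh : 0 < h) {B : ℝ} (hB : ∀ p, |ψ p| ≤ B) (p : ℝ × ℝ) :
    |tentIntegral h ψ p| ≤ B * h := by
  have := intervalIntegral.norm_integral_le_of_norm_le_const (a := 0) (b := h) (C := B)
    (f := fun s => (1 - s / h) * ψ (p.1 - s, p.2)) fun s hs => by
      rw [uIoc_of_le hh.le] at hs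
      rw [Real.norm_eq_abs, abs_mul]
      have h1 : |1 - s / h| ≤ 1 := by
        have : 0 < s / h := div_pos hs.1 hh
        have : s / h ≤ 1 := (div_le_one hh).2 hs.2
        rw [abs_le]
        constructor <;> linarith
      calc |1 - s / h| * |ψ (p.1 - s, p.2)| ≤ 1 * B :=
            mul_le_mul h1 (hB _) (abs_nonneg _) zero_le_one
        _ = B := one_mul B
  rwa [sub_zero, abs_of_pos hh] at this

lemma support_tentIntegral_subset (hh : 0 < h) :
    Function.support (tentIntegral h ψ) ⊆
      (fun q : (ℝ × ℝ) × ℝ => (q.1.1 + q.2, q.1.2)) '' (tsupport ψ ×ˢ Icc 0 h) := by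
  intro p hp
  by_contra hcon
  refine hp ?_
  have : ∀ s ∈ Icc 0 h, ψ (p.1 - s, p.2) = 0 := fun s hs => by
    by_contra hne
    exact hcon ⟨((p.1 - s, p.2), s), ⟨subset_tsupport _ hne, hs⟩, by simp⟩
  unfold tentIntegral
  rw [intervalIntegral.integral_congr (g := fun _ => 0)]
  · simp
  · intro s hs
    rw [uIcc_of_le hh.le] at hs
    simp [this s hs]

lemma isCompact_tent (hc : HasCompactSupport ψ) :
    IsCompact ((fun q : (ℝ × ℝ) × ℝ => (q.1.1 + q.2, q.1.2)) '' (tsupport ψ ×ˢ Icc 0 h)) :=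
  (IsCompact.prod hc isCompact_Icc).image (by fun_prop)

lemma hasCompactSupport_tentIntegral (hh : 0 < h) (hc : HasCompactSupport ψ) :
    HasCompactSupport (tentIntegral h ψ) :=
  HasCompactSupport.of_support_subset_isCompact (isCompact_tent hc) (support_tentIntegral_subset hh)

lemma tsupport_tentIntegral_subset (hh : 0 < h) (hc : HasCompactSupport ψ)
    (hs : tsupport ψ ⊆ halfStrip) : tsupport (tentIntegral h ψ) ⊆ halfStrip := by
  refine (closure_minimal (support_tentIntegral_subset hh) (isCompact_tent hc).isClosed).trans ?_
  rintro _ ⟨⟨q, s⟩, ⟨hq, hs'⟩, rfl⟩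
  have := hs hq
  exact ⟨add_pos_of_pos_of_nonneg this.1 hs'.1, this.2⟩

end Tent

variable {m C h : ℝ} {w : ℝ × ℝ → ℝ}

lemma IsProfile.measurable_segmentMean (hw : IsProfile m w) : Measurable (segmentMean h w) := by
  refine ((StronglyMeasurable.integral_prod_right (ν := volume.restrict (Ioc 0 h))
    (f := fun (p : ℝ × ℝ) s => w (p.1 + s, p.2)) ?_).measurable).const_mul _
  refine Measurable.stronglyMeasurable ?_
  exact hw.measurable.comp ((measurable_fst.fst.add measurable_snd).prodMk measurable_fst.snd)

lemma IsProfile.abs_segmentMean_le (hw : IsProfile m w) (hh : 0 < h) (p : ℝ × ℝ) :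
    |segmentMean h w p| ≤ m := by
  have : ‖∫ s in Ioc 0 h, w (p.1 + s, p.2)‖ ≤ m * volume.real (Ioc 0 h) :=
    norm_setIntegral_le_of_norm_le_const (by simp) fun s _ => hw.abs_le _
  rw [Real.volume_real_Ioc_of_le hh.le, sub_zero, Real.norm_eq_abs] at this
  rw [segmentMean, abs_mul, abs_of_pos (inv_pos.2 hh), inv_mul_le_iff₀ hh]
  linarith

/-- The pairing of a smooth test function with `w` minus its local means is the pairing of `w` with
the derivative of a test function of size `O(h)`. -/
lemma IsProfile.integral_sub_segmentMean_mul_le_of_contDiff (hw : IsProfile m w)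
    (hC : FstVariationLE C w) (hh : 0 < h) {ψ : ℝ × ℝ → ℝ} (hψ : ContDiff ℝ 1 ψ)
    (hc : HasCompactSupport ψ) (hs : tsupport ψ ⊆ halfStrip) {B : ℝ} (hB : ∀ p, |ψ p| ≤ B) :
    ∫ p, (w p - segmentMean h w p) * ψ p ≤ C * (B * h) := by
  have hψi : Integrable ψ := hψ.continuous.integrable_of_hasCompactSupport hc
  have key := hC _ (contDiff_tentIntegral hψ hc) (hasCompactSupport_tentIntegral hh hc)
    (tsupport_tentIntegral_subset hh hc hs) _ (abs_tentIntegral_le hh hB)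
  refine le_trans (le_of_eq ?_) key
  simp_rw [fderiv_tentIntegral hh.ne' hψ hc, mul_sub, sub_mul]
  have hk : IntegrableOn (fun _ => h⁻¹) (Ioc 0 h) := integrableOn_const (by simp)
  have e1 : ∀ p, segmentMean h w p * ψ p = ψ p * ∫ s in Ioc 0 h, h⁻¹ * w (p.1 + s, p.2) :=
    fun p => by rw [segmentMean, integral_const_mul]; ring
  have e2 : ∀ p, w p * (h⁻¹ * ∫ s in (0 : ℝ)..h, ψ (p.1 - s, p.2)) =
      w p * ∫ s in Ioc 0 h, h⁻¹ * ψ (p.1 + -s, p.2) := fun p => by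
    rw [integral_const_mul, intervalIntegral.integral_of_le hh.le]
    rfl
  simp_rw [e1, e2]
  have hwψ : Integrable fun p => w p * ψ p :=
    hψi.bdd_mul hw.measurable.aestronglyMeasurable (Filter.Eventually.of_forall hw.abs_le)
  rw [integral_sub hwψ (integrable_mul_correlation hψi hk measurable_id' hw.measurable hw.abs_le),
    integral_sub hwψ (integrable_mul_correlation hw.integrable hk measurable_neg
      hψ.continuous.measurable hB),
    integral_correlation_swap hψi hk measurable_id' hw.measurable hw.abs_le,
    integral_correlation_swap hw.integrable hk measurable_neg hψ.continuous.measurable hB]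
  congr 2
  ext s
  congr 1
  rw [← integral_comp_shift _ (-s)]
  congr 1
  ext p
  simp only [neg_add_cancel_right]
  ring

end AbelTV

namespace AbelTV

/-! ### Passing from smooth to bounded test functions -/

open scoped Convolution in
/-- A bounded measurable function supported in a compact subset of an open set is an almost
everywhere limit of smooth functions with the same bound and with supports in a fixed compact subset
of the open set. -/
lemma exists_contDiff_tendsto_ae {f : ℝ × ℝ → ℝ} {m : ℝ} {K U : Set (ℝ × ℝ)} (hf : Measurable f)
    (hm : ∀ p, |f p| ≤ m) (hK : IsCompact K) (hU : IsOpen U) (hKU : K ⊆ U)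
    (h0 : ∀ p, p ∉ K → f p = 0) :
    ∃ (L : Set (ℝ × ℝ)) (ψ : ℕ → ℝ × ℝ → ℝ), IsCompact L ∧ L ⊆ U ∧
      (∀ n, ContDiff ℝ 1 (ψ n) ∧ tsupport (ψ n) ⊆ L ∧ ∀ p, |ψ n p| ≤ m) ∧
      ∀ᵐ p, Filter.Tendsto (fun n => ψ n p) Filter.atTop (nhds (f p)) := by
  obtain ⟨δ, hδ, hδU⟩ := hK.exists_cthickening_subset_open hU hKU
  have hpos : ∀ n : ℕ, 0 < δ / (2 * ((n : ℝ) + 1)) := fun n => by positivity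
  let φ : ℕ → ContDiffBump (0 : ℝ × ℝ) := fun n =>
    ⟨δ / (2 * ((n : ℝ) + 1)), δ / ((n : ℝ) + 1), hpos n, by
      rw [div_lt_div_iff₀ (by positivity) (by positivity)]
      nlinarith [show (0 : ℝ) ≤ n from Nat.cast_nonneg n]⟩
  have hfi : Integrable f := integrable_of_abs_le_of_eq_zero hf.aestronglyMeasurable hm
    hK.measurableSet hK.measure_lt_top.ne h0
  refine ⟨Metric.cthickening δ K,
    fun n => (φ n).normed volume ⋆[ContinuousLinearMap.lsmul ℝ ℝ, volume] f,
    hK.cthickening, hδU, fun n => ⟨?_, ?_, fun p => ?_⟩, ?_⟩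
  · exact (φ n).hasCompactSupport_normed.contDiff_convolution_left _ (φ n).contDiff_normed
      hfi.locallyIntegrable
  · refine closure_minimal ((support_convolution_subset _).trans ?_) Metric.isClosed_cthickening
    rintro _ ⟨a, ha, b, hb, rfl⟩
    rw [(φ n).support_normed_eq, Metric.mem_ball, dist_zero_right] at ha
    have hbK : b ∈ K := by
      by_contra h
      exact hb (h0 b h)
    refine Metric.mem_cthickening_of_dist_le _ b δ K hbK ?_
    simp only [dist_eq_norm, add_sub_cancel_right]
    refine ha.le.trans ?_
    change δ / ((n : ℝ) + 1) ≤ δ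
    exact div_le_self hδ.le (by linarith [show (0 : ℝ) ≤ n from Nat.cast_nonneg n])
  · simp only [convolution_def, ← Real.norm_eq_abs]
    have h1 : ∫ t, (φ n).normed volume t * m = m := by
      rw [integral_mul_const, (φ n).integral_normed, one_mul]
    rw [← h1]
    refine norm_integral_le_of_norm_le ((φ n).integrable_normed.mul_const m)
      (Filter.Eventually.of_forall fun t => ?_)
    rw [ContinuousLinearMap.lsmul_apply, norm_smul, Real.norm_eq_abs, Real.norm_eq_abs,
      abs_of_nonneg ((φ n).nonneg_normed t)]
    exact mul_le_mul_of_nonneg_left (hm _) ((φ n).nonneg_normed t)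
  · refine ContDiffBump.ae_convolution_tendsto_right_of_locallyIntegrable (K := 2) ?_
      (Filter.Eventually.of_forall fun n => ?_) hfi.locallyIntegrable
    · have := (tendsto_one_div_add_atTop_nhds_zero_nat (𝕜 := ℝ)).const_mul δ
      simpa [φ, div_eq_mul_inv] using this
    · refine le_of_eq ?_
      change δ / ((n : ℝ) + 1) = 2 * (δ / (2 * ((n : ℝ) + 1)))
      field_simp

lemma isOpen_halfStrip : IsOpen halfStrip := isOpen_Ioi.prod isOpen_Ioo

variable {m C h : ℝ} {w : ℝ × ℝ → ℝ}

lemma IsProfile.abs_sub_segmentMean_le (hw : IsProfile m w) (hh : 0 < h) (p : ℝ × ℝ) :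
    |w p - segmentMean h w p| ≤ 2 * m := by
  have h1 := _root_.abs_le.1 (hw.abs_le p)
  have h2 := _root_.abs_le.1 (hw.abs_segmentMean_le hh p)
  rw [_root_.abs_le]
  constructor <;> linarith [h1.1, h1.2, h2.1, h2.2]

lemma IsProfile.integral_sub_segmentMean_mul_le_of_isCompact (hw : IsProfile m w)
    (hC : FstVariationLE C w) (hh : 0 < h) {f : ℝ × ℝ → ℝ} {B : ℝ} {K : Set (ℝ × ℝ)}
    (hf : Measurable f) (hB : ∀ p, |f p| ≤ B) (hK : IsCompact K) (hKU : K ⊆ halfStrip)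
    (h0 : ∀ p, p ∉ K → f p = 0) :
    ∫ p, (w p - segmentMean h w p) * f p ≤ C * (B * h) := by
  obtain ⟨L, ψ, hL, hLU, hψ, hlim⟩ := exists_contDiff_tendsto_ae hf hB hK isOpen_halfStrip hKU h0
  have hcs : ∀ n, HasCompactSupport (ψ n) := fun n =>
    hL.of_isClosed_subset (isClosed_tsupport _) (hψ n).2.1
  have hH := hw.measurable.sub (hw.measurable_segmentMean (h := h))
  have hi : Integrable (L.indicator fun _ => 2 * m * B) :=
    (integrable_indicator_iff hL.measurableSet).2 (integrableOn_const hL.measure_lt_top.ne)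
  have ht : Filter.Tendsto (fun n => ∫ p, (w p - segmentMean h w p) * ψ n p) Filter.atTop
      (nhds (∫ p, (w p - segmentMean h w p) * f p)) := by
    refine tendsto_integral_of_dominated_convergence _ (fun n => ?_) hi (fun n => ?_) ?_
    · exact (hH.mul (hψ n).1.continuous.measurable).aestronglyMeasurable
    · refine Filter.Eventually.of_forall fun p => ?_
      by_cases hp : p ∈ L
      · rw [indicator_of_mem hp, Real.norm_eq_abs, abs_mul]
        exact mul_le_mul (hw.abs_sub_segmentMean_le hh p) ((hψ n).2.2 p) (abs_nonneg _)
          (by linarith [hw.nonneg])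
      · rw [indicator_of_notMem hp, image_eq_zero_of_notMem_tsupport fun h => hp ((hψ n).2.1 h)]
        simp
    · filter_upwards [hlim] with p hp
      exact hp.const_mul _
  exact le_of_tendsto' ht fun n => hw.integral_sub_segmentMean_mul_le_of_contDiff hC hh (hψ n).1
    (hcs n) ((hψ n).2.1.trans hLU) (hψ n).2.2

/-- The compact rectangles `[1/(n+1), 1] × [-1 + 1/(n+1), 1 - 1/(n+1)]`, which exhaust the part of
the half strip that meets the support of a profile. -/
def innerRect (n : ℕ) : Set (ℝ × ℝ) :=
  Icc (1 / ((n : ℝ) + 1)) 1 ×ˢ Icc (-1 + 1 / ((n : ℝ) + 1)) (1 - 1 / ((n : ℝ) + 1))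

lemma isCompact_innerRect (n : ℕ) : IsCompact (innerRect n) := isCompact_Icc.prod isCompact_Icc

lemma innerRect_subset (n : ℕ) : innerRect n ⊆ halfStrip := by
  have h : 0 < 1 / ((n : ℝ) + 1) := by positivity
  intro p hp
  exact ⟨h.trans_le hp.1.1, by linarith [hp.2.1], by linarith [hp.2.2]⟩

lemma eventually_mem_innerRect {p : ℝ × ℝ} (hp : p ∈ Ioo (0 : ℝ) 1 ×ˢ Ioo (-1 : ℝ) 1) :
    ∀ᶠ n in Filter.atTop, p ∈ innerRect n := by
  have ht := tendsto_one_div_add_atTop_nhds_zero_nat (𝕜 := ℝ)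
  filter_upwards [ht.eventually_le_const hp.1.1,
    ht.eventually_le_const (show 0 < 1 + p.2 by linarith [hp.2.1]),
    ht.eventually_le_const (show 0 < 1 - p.2 by linarith [hp.2.2])] with n h1 h2 h3
  exact ⟨⟨h1, hp.1.2.le⟩, by linarith, by linarith⟩

lemma ae_snd_ne (a : ℝ) : ∀ᵐ p : ℝ × ℝ, p.2 ≠ a := by
  rw [Measure.volume_eq_prod]
  exact Measure.quasiMeasurePreserving_snd.ae (Measure.ae_ne volume a)

/-- The local means of a bounded profile of bounded variation are `O(h)`-close to it, tested against
the profile itself. -/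
lemma IsProfile.integral_sub_segmentMean_mul_self_le (hw : IsProfile m w)
    (hC : FstVariationLE C w) (hh : 0 < h) :
    ∫ p, (w p - segmentMean h w p) * w p ≤ C * (m * h) := by
  have hH := hw.measurable.sub (hw.measurable_segmentMean (h := h))
  have hmeas : ∀ n, Measurable ((innerRect n).indicator w) := fun n =>
    hw.measurable.indicator (isCompact_innerRect n).measurableSet
  have hle : ∀ n p, |(innerRect n).indicator w p| ≤ |w p| := fun n p => by
    by_cases hp : p ∈ innerRect n <;> simp [hp]
  have hi : Integrable fun p => 2 * m * |w p| := hw.integrable.abs.const_mul _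
  have ht : Filter.Tendsto
      (fun n => ∫ p, (w p - segmentMean h w p) * (innerRect n).indicator w p) Filter.atTop
      (nhds (∫ p, (w p - segmentMean h w p) * w p)) := by
    refine tendsto_integral_of_dominated_convergence _ (fun n => ?_) hi (fun n => ?_) ?_
    · exact (hH.mul (hmeas n)).aestronglyMeasurable
    · refine Filter.Eventually.of_forall fun p => ?_
      rw [Real.norm_eq_abs, abs_mul]
      exact mul_le_mul (hw.abs_sub_segmentMean_le hh p) (hle n p) (abs_nonneg _)
        (by linarith [hw.nonneg])
    · filter_upwards [ae_snd_ne 1, ae_snd_ne (-1)] with p h1 h2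
      refine Filter.Tendsto.const_mul _ ?_
      by_cases hp : p ∈ Ioo (0 : ℝ) 1 ×ˢ Icc (-1 : ℝ) 1
      · refine tendsto_const_nhds.congr' ?_
        filter_upwards [eventually_mem_innerRect (p := p)
          ⟨hp.1, lt_of_le_of_ne hp.2.1 h2.symm, lt_of_le_of_ne hp.2.2 h1⟩] with n hn
        rw [indicator_of_mem hn]
      · refine tendsto_const_nhds.congr fun n => ?_
        by_cases hn : p ∈ innerRect n <;> simp [hn, hw.eq_zero p hp]
  refine le_of_tendsto' ht fun n => hw.integral_sub_segmentMean_mul_le_of_isCompact hC hh (hmeas n)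
    (fun p => (hle n p).trans (hw.abs_le p)) (isCompact_innerRect n) (innerRect_subset n)
    fun p hp => indicator_of_notMem hp _

lemma IsProfile.integral_sq_eq (hw : IsProfile m w) (hh : 0 < h) :
    ∫ p, w p ^ 2 =
      (∫ p, w p * segmentMean h w p) + ∫ p, (w p - segmentMean h w p) * w p := by
  have h1 : Integrable fun p => segmentMean h w p * w p :=
    hw.integrable.bdd_mul hw.measurable_segmentMean.aestronglyMeasurable
      (Filter.Eventually.of_forall (hw.abs_segmentMean_le hh))
  have h2 := hw.integrable_sq.sub h1
  have h3 : Integrable fun p => w p * segmentMean h w p := by simpa only [mul_comm] using h1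
  have h4 : Integrable fun p => (w p - segmentMean h w p) * w p :=
    h2.congr (Filter.Eventually.of_forall fun p => by simp only [Pi.sub_apply]; ring)
  rw [← integral_add h3 h4]
  congr 1
  ext p
  ring

/-- If `A ≤ 4 a² / h + 2 P h` for all `0 < h ≤ 1` and `A ≤ 4 P`, then `A = O((a P)^(2/3))`: take
`h = a / √P` if this is at most `1`; otherwise the second bound suffices. -/
lemma pow_three_le_of_forall {A a P : ℝ} (hA : 0 ≤ A) (ha : 0 ≤ a) (hP : 0 ≤ P)
    (h1 : ∀ h, 0 < h → h ≤ 1 → A ≤ 4 * a ^ 2 / h + 2 * P * h) (h2 : A ≤ 4 * P) :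
    A ^ 3 ≤ 216 * (a * P) ^ 2 := by
  obtain ⟨q, hq, rfl⟩ : ∃ q : ℝ, 0 ≤ q ∧ q ^ 2 = P :=
    ⟨Real.sqrt P, Real.sqrt_nonneg P, Real.sq_sqrt hP⟩
  rcases lt_or_ge q a with hqa | hqa
  · calc A ^ 3 ≤ (4 * q ^ 2) ^ 3 := by gcongr
      _ = 64 * (q ^ 2 * q ^ 4) := by ring
      _ ≤ 216 * (a ^ 2 * q ^ 4) := by gcongr; norm_num
      _ = 216 * (a * q ^ 2) ^ 2 := by ring
  · rcases ha.eq_or_lt with rfl | ha0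
    · have : A ≤ 0 := by
        refine le_of_forall_pos_le_add fun ε hε => ?_
        have hd : 0 < 2 * q ^ 2 + ε := by positivity
        have := h1 (ε / (2 * q ^ 2 + ε)) (div_pos hε hd)
          ((div_le_one hd).2 (by nlinarith [sq_nonneg q]))
        refine this.trans ?_
        have h3 : 2 * q ^ 2 * (ε / (2 * q ^ 2 + ε)) ≤ ε := by
          rw [mul_div_assoc', div_le_iff₀ hd]
          nlinarith
        simpa using h3
      simp [le_antisymm this hA]
    · have hq0 : 0 < q := ha0.trans_le hqa
      have := h1 (a / q) (div_pos ha0 hq0) ((div_le_one hq0).2 hqa)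
      have h3 : A ≤ 6 * (a * q) := this.trans (le_of_eq (by field_simp; ring))
      calc A ^ 3 ≤ (6 * (a * q)) ^ 3 := by gcongr
        _ = 216 * (a ^ 2 * q ^ 3 * a) := by ring
        _ ≤ 216 * (a ^ 2 * q ^ 3 * q) := by gcongr
        _ = 216 * (a * q ^ 2) ^ 2 := by ring

/-- The interpolation inequality `‖w‖₂³ = O(C m ‖half-order integral of w‖₂)` for profiles bounded
by `m` with variation at most `C`. -/
theorem IsProfile.integral_sq_pow_three_le (hw : IsProfile m w) (hC0 : 0 ≤ C)
    (hC : FstVariationLE C w) {a : ℝ} (ha : 0 ≤ a)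
    (hG : ∫ p, halfTransform w p ^ 2 ≤ 2 * a ^ 2) :
    (∫ p, w p ^ 2) ^ 3 ≤ 216 * (a * (m * C)) ^ 2 := by
  refine pow_three_le_of_forall (integral_nonneg fun p => sq_nonneg _) ha
    (mul_nonneg hw.nonneg hC0) (fun h h0 h1 => ?_) ?_
  · have e := hw.integral_sq_eq h0
    have e1 := hw.integral_mul_segmentMean_le h0 h1
    have e2 := hw.integral_sub_segmentMean_mul_self_le hC h0
    have e3 : h⁻¹ * ∫ p, halfTransform w p ^ 2 ≤ h⁻¹ * (2 * a ^ 2) := by gcongr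
    have e4 : 4 * a ^ 2 / h = 2 * (h⁻¹ * (2 * a ^ 2)) := by field_simp; ring
    rw [e4]
    nlinarith
  · have e := hw.integral_sq_eq (h := 2) two_pos
    have e1 := hw.integral_mul_segmentMean_two_le
    have e2 := hw.integral_sub_segmentMean_mul_self_le hC (h := 2) two_pos
    nlinarith

end AbelTV

namespace AbelTV

/-! ### The substitution `t = r²` -/

/-- The profile as a function of the squared radius `t = r²`, extended by zero to `t ≤ 0`. -/
noncomputable def squaredRadius (v : ℝ × ℝ → ℝ) : ℝ × ℝ → ℝ :=
  rightHalf.indicator fun p => v (Real.sqrt p.1, p.2)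

lemma squaredRadius_sq (v : ℝ × ℝ → ℝ) {r : ℝ} (hr : 0 < r) (z : ℝ) :
    squaredRadius v (r ^ 2, z) = v (r, z) := by
  rw [squaredRadius, indicator_of_mem (show (r ^ 2, z) ∈ rightHalf from ⟨pow_pos hr 2, trivial⟩)]
  simp [Real.sqrt_sq hr.le]

lemma hasFDerivAt_sq_fst (p : ℝ × ℝ) :
    HasFDerivAt (fun p : ℝ × ℝ => (p.1 ^ 2, p.2))
      (((2 * p.1) • ContinuousLinearMap.id ℝ ℝ).prodMap (ContinuousLinearMap.id ℝ ℝ)) p := by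
  have h1 : HasFDerivAt (fun x : ℝ => x ^ 2) ((2 * p.1) • ContinuousLinearMap.id ℝ ℝ) p.1 := by
    have := (hasDerivAt_pow 2 p.1).hasFDerivAt
    convert! this using 1
    ext
    simp
  exact h1.prodMap p (hasFDerivAt_id p.2)

lemma det_sq_fst (x : ℝ) :
    (((2 * x) • ContinuousLinearMap.id ℝ ℝ).prodMap (ContinuousLinearMap.id ℝ ℝ)).det = 2 * x := by
  have : ((((2 * x) • ContinuousLinearMap.id ℝ ℝ).prodMap (ContinuousLinearMap.id ℝ ℝ) :
      ℝ × ℝ →L[ℝ] ℝ × ℝ) : ℝ × ℝ →ₗ[ℝ] ℝ × ℝ) =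
      ((2 * x) • LinearMap.id).prodMap LinearMap.id := rfl
  rw [ContinuousLinearMap.det, this, LinearMap.det_prodMap]
  simp

lemma injOn_sq_fst : InjOn (fun p : ℝ × ℝ => (p.1 ^ 2, p.2)) rightHalf := by
  intro p hp q hq h
  simp only [Prod.mk.injEq] at h
  exact Prod.ext ((pow_left_inj₀ (le_of_lt hp.1) (le_of_lt hq.1) two_ne_zero).1 h.1) h.2

lemma image_sq_fst : (fun p : ℝ × ℝ => (p.1 ^ 2, p.2)) '' rightHalf = rightHalf := by
  ext p
  constructor
  · rintro ⟨q, hq, rfl⟩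
    exact ⟨pow_pos (show 0 < q.1 from hq.1) 2, trivial⟩
  · intro hp
    refine ⟨(Real.sqrt p.1, p.2), ⟨Real.sqrt_pos.2 hp.1, trivial⟩, ?_⟩
    simp [Real.sq_sqrt (le_of_lt hp.1)]

lemma integral_sq_fst (F : ℝ × ℝ → ℝ) :
    ∫ p in rightHalf, F p = ∫ p in rightHalf, 2 * p.1 * F (p.1 ^ 2, p.2) := by
  conv_lhs => rw [← image_sq_fst]
  rw [integral_image_eq_integral_abs_det_fderiv_smul volume measurableSet_rightHalf
    (fun p _ => (hasFDerivAt_sq_fst p).hasFDerivWithinAt) injOn_sq_fst]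
  refine setIntegral_congr_fun measurableSet_rightHalf fun p hp => ?_
  have : 0 < p.1 := hp.1
  simp only [det_sq_fst, abs_of_pos (mul_pos two_pos this), smul_eq_mul]

lemma lintegral_sq_fst (F : ℝ × ℝ → ℝ≥0∞) :
    ∫⁻ p in rightHalf, F p =
      ∫⁻ p in rightHalf, ENNReal.ofReal (2 * p.1) * F (p.1 ^ 2, p.2) := by
  conv_lhs => rw [← image_sq_fst]
  rw [lintegral_image_eq_lintegral_abs_det_fderiv_mul volume measurableSet_rightHalf
    (fun p _ => (hasFDerivAt_sq_fst p).hasFDerivWithinAt) injOn_sq_fst]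
  refine setLIntegral_congr_fun measurableSet_rightHalf fun p hp => ?_
  have : 0 < p.1 := hp.1
  simp only [det_sq_fst, abs_of_pos (mul_pos two_pos this)]

/-- In the squared radius the Abel transform is half-order integration. No integrability is needed:
both integrals are related by the substitution `s = r² - x²`. -/
lemma abelTransform_eq_halfIntegral (v : ℝ × ℝ → ℝ) {p : ℝ × ℝ} (hp : 0 ≤ p.1) :
    abelTransform v p = halfIntegral (fun t => squaredRadius v (t, p.2)) (p.1 ^ 2) := by
  obtain ⟨x, z⟩ := p
  have hx : 0 ≤ x := hp
  change abelTransform v (x, z) = halfIntegral (fun t => squaredRadius v (t, z)) (x ^ 2)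
  have hd : ∀ r ∈ Ioi x, HasDerivWithinAt (fun r => r ^ 2 - x ^ 2) (2 * r) (Ioi x) r :=
    fun r _ => by simpa using ((hasDerivAt_pow 2 r).sub_const (x ^ 2)).hasDerivWithinAt
  have hinj : InjOn (fun r : ℝ => r ^ 2 - x ^ 2) (Ioi x) := by
    intro r hr s hs h
    have h' : r ^ 2 = s ^ 2 := by simpa using h
    exact (pow_left_inj₀ (hx.trans (le_of_lt hr)) (hx.trans (le_of_lt hs)) two_ne_zero).1 h'
  have him : (fun r : ℝ => r ^ 2 - x ^ 2) '' Ioi x = Ioi 0 := by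
    ext s
    constructor
    · rintro ⟨r, hr, rfl⟩
      have hr' : x < r := hr
      simp only [mem_Ioi, sub_pos]
      gcongr
    · intro hs
      have hs' : 0 < s := hs
      refine ⟨Real.sqrt (x ^ 2 + s), ?_, ?_⟩
      · exact Real.lt_sqrt_of_sq_lt (by linarith)
      · simp only
        rw [Real.sq_sqrt (by positivity)]
        ring
  have key := integral_image_eq_integral_abs_deriv_smul measurableSet_Ioi hd hinj
    (fun s => invSqrt s * squaredRadius v (x ^ 2 + s, z))
  rw [him] at key
  have e : halfIntegral (fun t => squaredRadius v (t, z)) (x ^ 2) =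
      ∫ s in Ioi 0, invSqrt s * squaredRadius v (x ^ 2 + s, z) := by
    refine (setIntegral_eq_integral_of_forall_compl_eq_zero fun s hs => ?_).symm
    rw [invSqrt_of_nonpos (not_lt.1 hs), zero_mul]
  rw [e, key, abelTransform, ← integral_const_mul]
  refine setIntegral_congr_fun measurableSet_Ioi fun r hr => ?_
  have hr' : 0 < r := hx.trans_lt hr
  simp only [add_sub_cancel, squaredRadius_sq v hr', smul_eq_mul, abs_of_pos (mul_pos two_pos hr'),
    invSqrt]
  ring

/-! ### Axisymmetric functions in cylindrical coordinates -/

/-- Integration in cylindrical coordinates, the angle being integrated out. -/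
lemma lintegral_axisymmetric {F : ℝ × ℝ → ℝ≥0∞} (hF : Measurable F) :
    ∫⁻ p : ℝ × ℝ × ℝ, F (Real.sqrt (p.1 ^ 2 + p.2.1 ^ 2), p.2.2) =
      ENNReal.ofReal Real.pi * ∫⁻ p in rightHalf, ENNReal.ofReal (2 * p.1) * F p := by
  have hmeas : Measurable fun p : ℝ × ℝ × ℝ => F (Real.sqrt (p.1 ^ 2 + p.2.1 ^ 2), p.2.2) := by
    fun_prop
  have hmeas2 : Measurable fun q : (ℝ × ℝ) × ℝ => F (Real.sqrt (q.1.1 ^ 2 + q.1.2 ^ 2), q.2) := by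
    fun_prop
  have hplane : ∀ z : ℝ, ∫⁻ q : ℝ × ℝ, F (Real.sqrt (q.1 ^ 2 + q.2 ^ 2), z) =
      ENNReal.ofReal Real.pi * ∫⁻ r in Ioi (0 : ℝ), ENNReal.ofReal (2 * r) * F (r, z) := fun z => by
    rw [← lintegral_comp_polarCoord_symm]
    have e : ∀ p ∈ polarCoord.target, ENNReal.ofReal p.1 •
        F (Real.sqrt ((polarCoord.symm p).1 ^ 2 + (polarCoord.symm p).2 ^ 2), z) =
        ENNReal.ofReal p.1 * F (p.1, z) := fun p hp => by
      have hp1 : 0 < p.1 := by simpa using hp.1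
      rw [smul_eq_mul, polarCoord_symm_apply]
      have : (p.1 * Real.cos p.2) ^ 2 + (p.1 * Real.sin p.2) ^ 2 = p.1 ^ 2 := by
        linear_combination p.1 ^ 2 * Real.sin_sq_add_cos_sq p.2
      rw [this, Real.sqrt_sq hp1.le]
    rw [setLIntegral_congr_fun polarCoord.open_target.measurableSet e, polarCoord_target,
      Measure.volume_eq_prod, setLIntegral_prod _ (by fun_prop)]
    simp only [lintegral_const, MeasurableSet.univ, Measure.restrict_apply, univ_inter,
      Real.volume_Ioo]
    rw [← lintegral_const_mul _ (by fun_prop)]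
    refine lintegral_congr fun r => ?_
    rw [show Real.pi - -Real.pi = 2 * Real.pi by ring, ENNReal.ofReal_mul zero_le_two,
      ENNReal.ofReal_mul zero_le_two]
    ring
  rw [← (volume_preserving_prodAssoc (α₁ := ℝ) (β₁ := ℝ) (γ₁ := ℝ)).lintegral_comp hmeas]
  change ∫⁻ q : (ℝ × ℝ) × ℝ, F (Real.sqrt (q.1.1 ^ 2 + q.1.2 ^ 2), q.2) = _
  rw [Measure.volume_eq_prod, lintegral_prod_symm' _ hmeas2]
  simp_rw [hplane]
  rw [lintegral_const_mul _ (Measurable.lintegral_prod_right (by fun_prop)), rightHalf,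
    Measure.volume_eq_prod, setLIntegral_prod_symm _ (by fun_prop), Measure.restrict_univ]

/-- Rotating a null set of the half plane about the axis gives a null set of space. -/
lemma ae_axisymmetric {P : ℝ × ℝ → Prop} (h : ∀ᵐ p, P p) :
    ∀ᵐ p : ℝ × ℝ × ℝ, P (Real.sqrt (p.1 ^ 2 + p.2.1 ^ 2), p.2.2) := by
  obtain ⟨N, hN, hNm, hN0⟩ := exists_measurable_superset_of_null (ae_iff.1 h)
  have hF : Measurable (N.indicator fun _ => (1 : ℝ≥0∞)) := measurable_const.indicator hNm
  have h0 := lintegral_axisymmetric hF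
  have e : ∫⁻ p in rightHalf,
      ENNReal.ofReal (2 * p.1) * N.indicator (fun _ => (1 : ℝ≥0∞)) p = 0 := by
    rw [lintegral_eq_zero_iff (by fun_prop)]
    refine ae_restrict_of_ae ?_
    filter_upwards [measure_eq_zero_iff_ae_notMem.1 hN0] with p hp
    simp [hp]
  rw [e, mul_zero, lintegral_eq_zero_iff (by fun_prop)] at h0
  filter_upwards [h0] with p hp
  by_contra hcon
  have : (Real.sqrt (p.1 ^ 2 + p.2.1 ^ 2), p.2.2) ∈ N := hN hcon
  simp [this] at hp

end AbelTV

namespace AbelTV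

/-! ### Bounded profiles supported away from the lateral boundary -/

/-- Measurable profiles that are bounded by `m` everywhere and vanish outside
`[0, ρ] × [-1, 1]` for some `ρ < 1`. -/
structure IsInnerProfile (m : ℝ) (v : ℝ × ℝ → ℝ) : Prop where
  measurable : Measurable v
  abs_le : ∀ p, |v p| ≤ m
  eq_zero : ∃ ρ < 1, ∀ p, p ∉ Icc (0 : ℝ) ρ ×ˢ Icc (-1 : ℝ) 1 → v p = 0

lemma interior_rect : interior rect = Ioo (0 : ℝ) 1 ×ˢ Ioo (-1 : ℝ) 1 := by
  rw [rect, interior_prod_eq, interior_Icc, interior_Icc]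

lemma measurableSet_rect : MeasurableSet rect := measurableSet_Icc.prod measurableSet_Icc

lemma volume_rect : volume rect = 2 := by
  rw [rect, Measure.volume_eq_prod, Measure.prod_prod, Real.volume_Icc, Real.volume_Icc]
  norm_num

namespace IsInnerProfile

variable {m m' C : ℝ} {v v' : ℝ × ℝ → ℝ}

lemma sub (hv : IsInnerProfile m v) (hv' : IsInnerProfile m' v') :
    IsInnerProfile (m + m') (v - v') := by
  refine ⟨hv.measurable.sub hv'.measurable, fun p => ?_, ?_⟩
  · exact (abs_sub _ _).trans (add_le_add (hv.abs_le p) (hv'.abs_le p))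
  · obtain ⟨ρ, h1, h2⟩ := hv.eq_zero
    obtain ⟨ρ', h1', h2'⟩ := hv'.eq_zero
    refine ⟨max ρ ρ', max_lt h1 h1', fun p hp => ?_⟩
    rw [Pi.sub_apply, h2 p fun h => hp ⟨⟨h.1.1, h.1.2.trans (le_max_left _ _)⟩, h.2⟩,
      h2' p fun h => hp ⟨⟨h.1.1, h.1.2.trans (le_max_right _ _)⟩, h.2⟩, sub_zero]

lemma eq_zero_of_notMem_rect (hv : IsInnerProfile m v) {p : ℝ × ℝ} (hp : p ∉ rect) : v p = 0 := by
  obtain ⟨ρ, h1, h2⟩ := hv.eq_zero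
  exact h2 p fun h => hp ⟨⟨h.1.1, h.1.2.trans h1.le⟩, h.2⟩

lemma isProfile (hv : IsInnerProfile m v) : IsProfile m (squaredRadius v) := by
  have hmeas : Measurable fun p : ℝ × ℝ => v (Real.sqrt p.1, p.2) := by
    have := hv.measurable
    fun_prop
  refine ⟨hmeas.indicator measurableSet_rightHalf, fun p => ?_, fun p hp => ?_⟩
  · by_cases h : p ∈ rightHalf
    · rw [squaredRadius, indicator_of_mem h]
      exact hv.abs_le _
    · rw [squaredRadius, indicator_of_notMem h, abs_zero]
      exact (abs_nonneg _).trans (hv.abs_le 0)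
  · by_cases h : p ∈ rightHalf
    · rw [squaredRadius, indicator_of_mem h]
      obtain ⟨ρ, h1, h2⟩ := hv.eq_zero
      refine h2 _ fun hmem => hp ⟨⟨h.1, ?_⟩, hmem.2⟩
      have h3 : Real.sqrt p.1 < 1 := hmem.1.2.trans_lt h1
      by_contra hge
      exact absurd (Real.one_le_sqrt.2 (not_lt.1 hge)) (not_le.2 h3)
    · exact indicator_of_notMem h _

lemma abelTransform_sub (hv : IsInnerProfile m v) (hv' : IsInnerProfile m' v') {p : ℝ × ℝ}
    (hp : 0 ≤ p.1) : abelTransform (v - v') p = abelTransform v p - abelTransform v' p := by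
  rw [abelTransform_eq_halfIntegral _ hp, abelTransform_eq_halfIntegral _ hp,
    abelTransform_eq_halfIntegral _ hp]
  have hw := hv.isProfile
  have hw' := hv'.isProfile
  unfold halfIntegral
  rw [← integral_sub (integrable_invSqrt_mul (hw.measurable_slice p.2) (fun t => hw.abs_le _)
      (hw.slice_eq_zero p.2) _) (integrable_invSqrt_mul (hw'.measurable_slice p.2)
      (fun t => hw'.abs_le _) (hw'.slice_eq_zero p.2) _)]
  congr 1
  ext s
  rw [← mul_sub]
  congr 1
  simp only [squaredRadius, indicator]
  split_ifs <;> simp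

lemma aestronglyMeasurable_abelTransform (hv : IsInnerProfile m v) :
    AEStronglyMeasurable (abelTransform v) (volume.restrict rect) := by
  have h : Measurable fun p : ℝ × ℝ =>
      halfIntegral (fun t => squaredRadius v (t, p.2)) (p.1 ^ 2) :=
    hv.isProfile.measurable_halfIntegral.comp
      ((measurable_fst.pow_const 2).prodMk measurable_snd)
  refine h.aestronglyMeasurable.congr ?_
  filter_upwards [ae_restrict_mem measurableSet_rect] with p hp
  exact (abelTransform_eq_halfIntegral v hp.1.1).symm

lemma lintegral_halfTransform_sq_le (hv : IsInnerProfile m v) :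
    ∫⁻ p, ‖halfTransform (squaredRadius v) p‖ₑ ^ 2 ≤
      2 * ∫⁻ p in rect, ‖abelTransform v p‖ₑ ^ 2 := by
  have hG := hv.isProfile.halfTransform_isProfile
  have e1 : ∫⁻ p, ‖halfTransform (squaredRadius v) p‖ₑ ^ 2 =
      ∫⁻ p in rightHalf, ‖halfTransform (squaredRadius v) p‖ₑ ^ 2 := by
    rw [← lintegral_indicator measurableSet_rightHalf]
    refine lintegral_congr fun p => ?_
    by_cases hp : p ∈ rightHalf
    · rw [indicator_of_mem hp]
    · rw [indicator_of_notMem hp, hG.eq_zero p fun h => hp ⟨h.1.1, trivial⟩]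
      simp
  rw [e1, lintegral_sq_fst, ← lintegral_const_mul' _ _ (by simp),
    ← lintegral_indicator measurableSet_rightHalf, ← lintegral_indicator measurableSet_rect]
  refine lintegral_mono fun p => ?_
  by_cases hp : p ∈ rightHalf
  · have hp0 : 0 < p.1 := hp.1
    rw [indicator_of_mem hp]
    by_cases hr : p ∈ rect
    · rw [indicator_of_mem hr, abelTransform_eq_halfIntegral v hp0.le, halfTransform,
        indicator_of_mem (show (p.1 ^ 2, p.2) ∈ rightHalf from ⟨pow_pos hp0 2, trivial⟩)]
      gcongr
      rw [← ENNReal.ofReal_ofNat]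
      exact ENNReal.ofReal_le_ofReal (by linarith [hr.1.2])
    · rw [hG.eq_zero]
      · simp
      · intro h
        exact hr ⟨⟨hp0.le, ((sq_lt_one_iff₀ hp0.le).1 h.1.2).le⟩, h.2⟩
  · rw [indicator_of_notMem hp]
    exact zero_le

/-- The variation of a profile in `Ω` controls the variation of the same profile in the squared
radius, because total variation does not depend on the parametrization. A cutoff in `r` makes the
transported test function admissible at `r = 0` and `r = 1`; near `r = 1` the profile vanishes. -/
lemma fstVariationLE (hv : IsInnerProfile m v)
    (hC : ∀ φ₁ φ₂, IsTestField φ₁ φ₂ → ∫ p in rect, v p * divergence φ₁ φ₂ p ≤ C) :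
    FstVariationLE C (squaredRadius v) := by
  intro Φ hΦ hc hs B hB
  rcases ((abs_nonneg _).trans (hB 0)).eq_or_lt with rfl | hB0
  · have : Φ = 0 := by
      ext p
      exact abs_nonpos_iff.1 (hB p)
    simp [this]
  obtain ⟨ρ, hρ1, hρ⟩ := hv.eq_zero
  obtain ⟨δ, hδ0, hδ⟩ : ∃ δ > 0, ∀ p ∈ tsupport Φ, δ ≤ p.1 := by
    rcases (tsupport Φ).eq_empty_or_nonempty with he | hne
    · exact ⟨1, one_pos, by simp [he]⟩
    · obtain ⟨q, hq, hmin⟩ := IsCompact.exists_isMinOn hc hne continuous_fst.continuousOn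
      exact ⟨q.1, (hs hq).1, fun p hp => hmin hp⟩
  obtain ⟨ε, hε0, hε⟩ := exists_between
    (show 0 < min (min (1 / 2) (1 - ρ)) δ from
      lt_min (lt_min (by norm_num) (by linarith)) hδ0)
  have hε1 : ε < 1 / 2 := hε.trans_le ((min_le_left _ _).trans (min_le_left _ _))
  have hε2 : ε < 1 - ρ := hε.trans_le ((min_le_left _ _).trans (min_le_right _ _))
  have hε3 : ε < δ := hε.trans_le (min_le_right _ _)
  let χ : ContDiffBump (1 / 2 : ℝ) :=
    ⟨1 / 2 - ε, 1 / 2 - ε / 2, by linarith, by linarith⟩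
  let Ψ : ℝ × ℝ → ℝ := fun p => Φ (p.1 ^ 2, p.2)
  let φ : ℝ × ℝ → ℝ := fun p => B⁻¹ * (χ p.1 * Ψ p)
  have hΨd : ∀ p : ℝ × ℝ, HasFDerivAt Ψ ((fderiv ℝ Φ (p.1 ^ 2, p.2)).comp
      (((2 * p.1) • ContinuousLinearMap.id ℝ ℝ).prodMap (ContinuousLinearMap.id ℝ ℝ))) p :=
    fun p => (hΦ.differentiable (by simp) _).hasFDerivAt.comp p (hasFDerivAt_sq_fst p)
  have hΨ1 : ∀ p : ℝ × ℝ, fderiv ℝ Ψ p (1, 0) = 2 * p.1 * fderiv ℝ Φ (p.1 ^ 2, p.2) (1, 0) := by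
    intro p
    have e : ((2 * p.1, 0) : ℝ × ℝ) = (2 * p.1) • (1, 0) := by simp
    have e' : (((2 * p.1) • ContinuousLinearMap.id ℝ ℝ).prodMap (ContinuousLinearMap.id ℝ ℝ)) (1, 0)
        = (2 * p.1, (0 : ℝ)) := by ext <;> simp
    rw [(hΨd p).fderiv, ContinuousLinearMap.comp_apply, e', e, map_smul, smul_eq_mul]
  have hφc : ContDiff ℝ 1 φ := by
    have h1 : ContDiff ℝ 1 (χ : ℝ → ℝ) := χ.contDiff
    have h2 : ContDiff ℝ 1 Ψ := hΦ.comp (by fun_prop)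
    exact contDiff_const.mul ((h1.comp contDiff_fst).mul h2)
  have hKc : IsClosed ((Icc (ε / 2) (1 - ε / 2) ×ˢ univ) ∩
      (fun p : ℝ × ℝ => (p.1 ^ 2, p.2)) ⁻¹' tsupport Φ) :=
    (isClosed_Icc.prod isClosed_univ).inter ((isClosed_tsupport Φ).preimage (by fun_prop))
  have hsupp : Function.support φ ⊆ (Icc (ε / 2) (1 - ε / 2) ×ˢ univ) ∩
      (fun p : ℝ × ℝ => (p.1 ^ 2, p.2)) ⁻¹' tsupport Φ := by
    intro p hp
    have hp' : χ p.1 ≠ 0 ∧ Ψ p ≠ 0 := by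
      constructor <;> intro h <;> exact hp (by simp [φ, h])
    refine ⟨⟨?_, trivial⟩, subset_tsupport _ hp'.2⟩
    have h1 : p.1 ∈ Function.support χ := hp'.1
    rw [χ.support_eq, Metric.mem_ball, Real.dist_eq, abs_lt] at h1
    simp only [χ] at h1
    constructor <;> linarith [h1.1, h1.2]
  have hts := closure_minimal hsupp hKc
  have hint : tsupport φ ⊆ interior rect := by
    rw [interior_rect]
    intro p hp
    have h := hts hp
    exact ⟨⟨by linarith [h.1.1.1], by linarith [h.1.1.2]⟩, (hs h.2).2⟩
  have hφcs : HasCompactSupport φ :=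
    (isCompact_Icc.prod isCompact_Icc : IsCompact rect).of_isClosed_subset (isClosed_tsupport _)
      (hint.trans interior_subset)
  have htest : IsTestField φ 0 :=
    { contDiff_fst := hφc
      contDiff_snd := contDiff_const
      compact_fst := hφcs
      compact_snd := HasCompactSupport.zero
      supp_fst := hint
      supp_snd := by simp [tsupport]
      norm_le := fun p => by
        have h1 : |φ p| ≤ 1 := by
          simp only [φ, Ψ]
          rw [abs_mul, abs_mul, abs_of_pos (inv_pos.2 hB0), abs_of_nonneg χ.nonneg,
            inv_mul_le_iff₀ hB0, mul_one]
          calc χ p.1 * |Φ (p.1 ^ 2, p.2)| ≤ 1 * B :=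
                mul_le_mul χ.le_one (hB _) (abs_nonneg _) zero_le_one
            _ = B := one_mul B
        simpa using h1 }
  have hdiv : ∀ p : ℝ × ℝ, 0 ≤ p.1 → v p * divergence φ 0 p =
      B⁻¹ * (2 * p.1 * (v p * fderiv ℝ Φ (p.1 ^ 2, p.2) (1, 0))) := by
    intro p hp0
    by_cases hvp : v p = 0
    · simp [hvp]
    have hpρ : p.1 ≤ ρ := by
      by_contra h
      exact hvp (hρ p fun hm => h hm.1.2)
    have hd0 : divergence φ 0 p = fderiv ℝ φ p (1, 0) := by simp [divergence]
    suffices h : fderiv ℝ φ p (1, 0) = B⁻¹ * fderiv ℝ Ψ p (1, 0) by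
      rw [hd0, h, hΨ1]
      ring
    rcases le_or_gt p.1 ε with hpε | hpε
    · -- `Ψ` vanishes near `p`, hence so does `φ`
      have hsq : p.1 ^ 2 < δ := by nlinarith
      have hev : Ψ =ᶠ[nhds p] fun _ => 0 := by
        have : ∀ᶠ q : ℝ × ℝ in nhds p, q.1 ^ 2 < δ :=
          (show Continuous fun q : ℝ × ℝ => q.1 ^ 2 by fun_prop).continuousAt.eventually_lt
            continuousAt_const hsq
        filter_upwards [this] with q hq
        exact image_eq_zero_of_notMem_tsupport (f := Φ) fun h =>
          absurd (hδ (q.1 ^ 2, q.2) h) (not_le.2 hq)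
      have hev' : φ =ᶠ[nhds p] fun _ => 0 := by
        filter_upwards [hev] with q hq
        simp [φ, hq]
      rw [hev.fderiv_eq, hev'.fderiv_eq]
      simp
    · have hev : φ =ᶠ[nhds p] fun q => B⁻¹ * Ψ q := by
        have h1 : ∀ᶠ q : ℝ × ℝ in nhds p, ε < q.1 :=
          continuousAt_const.eventually_lt continuous_fst.continuousAt hpε
        have h2 : ∀ᶠ q : ℝ × ℝ in nhds p, q.1 < 1 - ε :=
          continuous_fst.continuousAt.eventually_lt continuousAt_const (by linarith)
        filter_upwards [h1, h2] with q hq1 hq2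
        have : χ q.1 = 1 := by
          refine χ.one_of_mem_closedBall ?_
          rw [Metric.mem_closedBall, Real.dist_eq, _root_.abs_le]
          constructor <;> simp only [χ] <;> linarith
        simp [φ, this]
      rw [hev.fderiv_eq, ((hΨd p).const_mul B⁻¹).fderiv, (hΨd p).fderiv]
      rfl
  have key := hC φ 0 htest
  have e1 : ∫ p in rect, v p * divergence φ 0 p = B⁻¹ *
      ∫ p in rect, 2 * p.1 * (v p * fderiv ℝ Φ (p.1 ^ 2, p.2) (1, 0)) := by
    rw [← integral_const_mul]
    exact setIntegral_congr_fun measurableSet_rect fun p hp => hdiv p hp.1.1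
  have e2 : ∫ p in rect, 2 * p.1 * (v p * fderiv ℝ Φ (p.1 ^ 2, p.2) (1, 0)) =
      ∫ p in rightHalf, 2 * p.1 * (v p * fderiv ℝ Φ (p.1 ^ 2, p.2) (1, 0)) := by
    rw [setIntegral_eq_integral_of_forall_compl_eq_zero,
      setIntegral_eq_integral_of_forall_compl_eq_zero]
    · intro p hp
      have hp0 : p.1 ≤ 0 := not_lt.1 fun h => hp ⟨h, trivial⟩
      rcases hp0.eq_or_lt with h | h
      · simp [h]
      · rw [hρ p fun hm => absurd hm.1.1 (not_le.2 h)]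
        simp
    · intro p hp
      rw [hv.eq_zero_of_notMem_rect hp]
      simp
  have e3 : ∫ p in rightHalf, 2 * p.1 * (v p * fderiv ℝ Φ (p.1 ^ 2, p.2) (1, 0)) =
      ∫ p, squaredRadius v p * fderiv ℝ Φ p (1, 0) := by
    have h0 : ∀ p, p ∉ rightHalf → squaredRadius v p * fderiv ℝ Φ p (1, 0) = 0 := fun p hp => by
      rw [squaredRadius, indicator_of_notMem hp, zero_mul]
    rw [← setIntegral_eq_integral_of_forall_compl_eq_zero h0,
      integral_sq_fst fun p => squaredRadius v p * fderiv ℝ Φ p (1, 0)]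
    refine setIntegral_congr_fun measurableSet_rightHalf fun p hp => ?_
    rw [squaredRadius_sq v (show 0 < p.1 from hp.1)]
  rw [e1, e2, e3, inv_mul_le_iff₀ hB0] at key
  linarith

end IsInnerProfile

/-- The square of the `L²` norm as an integral. -/
lemma eLpNorm_two_sq {α : Type*} [MeasurableSpace α] (μ : Measure α) (f : α → ℝ) :
    eLpNorm f 2 μ ^ 2 = ∫⁻ x, ‖f x‖ₑ ^ 2 ∂μ := by
  have := eLpNorm_nnreal_pow_eq_lintegral (f := f) (μ := μ) (p := 2) two_ne_zero
  simpa using this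

lemma IsProfile.lintegral_sq {m : ℝ} {w : ℝ × ℝ → ℝ} (hw : IsProfile m w) :
    ∫⁻ p, ‖w p‖ₑ ^ 2 = ENNReal.ofReal (∫ p, w p ^ 2) := by
  rw [ofReal_integral_eq_lintegral_ofReal hw.integrable_sq
    (Filter.Eventually.of_forall fun p => sq_nonneg _)]
  refine lintegral_congr fun p => ?_
  rw [← sq_abs, ENNReal.ofReal_pow (abs_nonneg _), Real.enorm_eq_ofReal_abs]

lemma IsInnerProfile.eLpNorm_axisymmetric_sq_le {m : ℝ} {v : ℝ × ℝ → ℝ}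
    (hv : IsInnerProfile m v) :
    eLpNorm (axisymmetric v) 2 (volume.restrict cylinder) ^ 2 ≤
      ENNReal.ofReal (Real.pi * ∫ p, squaredRadius v p ^ 2) := by
  have hw := hv.isProfile
  have hm : Measurable fun p => ‖v p‖ₑ ^ 2 := hv.measurable.enorm.pow_const 2
  rw [eLpNorm_two_sq, ENNReal.ofReal_mul Real.pi_pos.le, ← hw.lintegral_sq]
  refine (setLIntegral_le_lintegral _ _).trans (le_of_eq ?_)
  refine (lintegral_axisymmetric hm).trans ?_
  congr 1
  calc ∫⁻ p in rightHalf, ENNReal.ofReal (2 * p.1) * ‖v p‖ₑ ^ 2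
      = ∫⁻ p in rightHalf, ENNReal.ofReal (2 * p.1) * ‖squaredRadius v (p.1 ^ 2, p.2)‖ₑ ^ 2 := by
        refine setLIntegral_congr_fun measurableSet_rightHalf fun p hp => ?_
        rw [squaredRadius_sq v (show 0 < p.1 from hp.1)]
    _ = ∫⁻ p in rightHalf, ‖squaredRadius v p‖ₑ ^ 2 :=
        (lintegral_sq_fst fun p => ‖squaredRadius v p‖ₑ ^ 2).symm
    _ = ∫⁻ p, ‖squaredRadius v p‖ₑ ^ 2 := by
        rw [← lintegral_indicator measurableSet_rightHalf]
        refine lintegral_congr fun p => ?_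
        by_cases hp : p ∈ rightHalf
        · rw [indicator_of_mem hp]
        · rw [indicator_of_notMem hp, squaredRadius, indicator_of_notMem hp]
          simp

/-- Stability of the inversion of the Abel transform on bounded profiles of bounded variation. -/
theorem IsInnerProfile.eLpNorm_axisymmetric_pow_three_le {m C : ℝ} {v : ℝ × ℝ → ℝ}
    (hv : IsInnerProfile m v) (hC0 : 0 ≤ C)
    (hC : ∀ φ₁ φ₂, IsTestField φ₁ φ₂ → ∫ p in rect, v p * divergence φ₁ φ₂ p ≤ C)
    (hfin : eLpNorm (abelTransform v) 2 (volume.restrict rect) ≠ ∞) :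
    eLpNorm (axisymmetric v) 2 (volume.restrict cylinder) ^ 3 ≤
      ENNReal.ofReal (125 * (m * C)) * eLpNorm (abelTransform v) 2 (volume.restrict rect) := by
  have hw := hv.isProfile
  set a := (eLpNorm (abelTransform v) 2 (volume.restrict rect)).toReal with ha
  have ha' : ENNReal.ofReal a = eLpNorm (abelTransform v) 2 (volume.restrict rect) :=
    ENNReal.ofReal_toReal hfin
  have ha0 : 0 ≤ a := ENNReal.toReal_nonneg
  have hm0 : 0 ≤ m := hw.nonneg
  have hG : ∫ p, halfTransform (squaredRadius v) p ^ 2 ≤ 2 * a ^ 2 := by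
    have h := hv.lintegral_halfTransform_sq_le
    rw [hw.halfTransform_isProfile.lintegral_sq, ← eLpNorm_two_sq, ← ha',
      ← ENNReal.ofReal_pow ha0, ← ENNReal.ofReal_ofNat, ← ENNReal.ofReal_mul zero_le_two] at h
    exact (ENNReal.ofReal_le_ofReal_iff (by positivity)).1 h
  have key := hw.integral_sq_pow_three_le hC0 (hv.fstVariationLE hC) ha0 hG
  set A := ∫ p, squaredRadius v p ^ 2
  have hA0 : 0 ≤ A := integral_nonneg fun p => sq_nonneg _
  have hd := hv.eLpNorm_axisymmetric_sq_le
  rw [← ha', ← ENNReal.ofReal_mul (by positivity)]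
  refine (ENNReal.pow_le_pow_left_iff two_ne_zero).1 ?_
  calc (eLpNorm (axisymmetric v) 2 (volume.restrict cylinder) ^ 3) ^ 2
      = (eLpNorm (axisymmetric v) 2 (volume.restrict cylinder) ^ 2) ^ 3 := by ring
    _ ≤ ENNReal.ofReal (Real.pi * A) ^ 3 := by gcongr
    _ = ENNReal.ofReal ((Real.pi * A) ^ 3) := (ENNReal.ofReal_pow (by positivity) 3).symm
    _ ≤ ENNReal.ofReal ((125 * (m * C) * a) ^ 2) := by
        refine ENNReal.ofReal_le_ofReal ?_
        have hpi : Real.pi ^ 3 ≤ 4 ^ 3 := by gcongr; exact Real.pi_le_four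
        calc (Real.pi * A) ^ 3 = Real.pi ^ 3 * A ^ 3 := by ring
          _ ≤ 4 ^ 3 * (216 * (a * (m * C)) ^ 2) := by gcongr
          _ = 13824 * (a * (m * C)) ^ 2 := by ring
          _ ≤ 15625 * (a * (m * C)) ^ 2 := by gcongr; norm_num
          _ = (125 * (m * C) * a) ^ 2 := by ring
    _ = ENNReal.ofReal (125 * (m * C) * a) ^ 2 := ENNReal.ofReal_pow (by positivity) 2

end AbelTV

namespace AbelTV

/-! ### Regular representatives and the deterministic estimate -/

section Representative

variable {c M : ℝ≥0} {u u' : ℝ × ℝ → ℝ}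

lemma SupportedInside.eq_zero (hs : SupportedInside u) {p : ℝ × ℝ} (hp : p ∉ rect) : u p = 0 :=
  image_eq_zero_of_notMem_tsupport fun h => hp ⟨⟨(hs h).1.1, (hs h).1.2.le⟩, (hs h).2⟩

lemma SupportedInside.abelOn_eq (hs : SupportedInside u) : abelOn u = abelTransform u := by
  have : rect.indicator u = u := by
    ext p
    by_cases hp : p ∈ rect
    · rw [indicator_of_mem hp]
    · rw [indicator_of_notMem hp, hs.eq_zero hp]
  rw [abelOn, this]

lemma SupportedInside.exists_lt_one (hs : SupportedInside u) :
    ∃ ρ < 1, ∀ p, p ∉ Icc (0 : ℝ) ρ ×ˢ Icc (-1 : ℝ) 1 → u p = 0 := by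
  rcases (tsupport u).eq_empty_or_nonempty with he | hne
  · exact ⟨0, zero_lt_one, fun p _ => image_eq_zero_of_notMem_tsupport (by simp [he])⟩
  · have hc : IsCompact (tsupport u) :=
      (isCompact_Icc.prod isCompact_Icc : IsCompact rect).of_isClosed_subset (isClosed_tsupport u)
        fun p hp => ⟨⟨(hs hp).1.1, (hs hp).1.2.le⟩, (hs hp).2⟩
    obtain ⟨q, hq, hmax⟩ := hc.exists_isMaxOn hne continuous_fst.continuousOn
    exact ⟨q.1, (hs hq).1.2, fun p hp => image_eq_zero_of_notMem_tsupport fun h =>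
      hp ⟨⟨(hs h).1.1, hmax h⟩, (hs h).2⟩⟩

/-- Elements of the bounded class with support in `[0,1) × [-1,1]` have a representative for which the
bound holds everywhere and measurability is not up to null sets. -/
lemma exists_isInnerProfile (hu : u ∈ boundedClass c M) (hs : SupportedInside u) :
    ∃ v, IsInnerProfile M v ∧ v =ᵐ[volume] u := by
  obtain ⟨ρ, hρ1, hρ⟩ := hs.exists_lt_one
  have hm := hu.1.1.aestronglyMeasurable
  have hsub : Icc (0 : ℝ) ρ ×ˢ Icc (-1 : ℝ) 1 ⊆ rect :=
    prod_mono (Icc_subset_Icc_right hρ1.le) le_rfl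
  have hM0 : (0 : ℝ) ≤ M := M.2
  refine ⟨(Icc (0 : ℝ) ρ ×ˢ Icc (-1 : ℝ) 1).indicator fun p => max (-(M : ℝ)) (min M (hm.mk u p)),
    ⟨?_, fun p => ?_, ρ, hρ1, fun p hp => indicator_of_notMem hp _⟩, ?_⟩
  · exact (measurable_const.max (measurable_const.min hm.stronglyMeasurable_mk.measurable)).indicator
      (measurableSet_Icc.prod measurableSet_Icc)
  · by_cases hp : p ∈ Icc (0 : ℝ) ρ ×ˢ Icc (-1 : ℝ) 1
    · rw [indicator_of_mem hp, abs_le]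
      exact ⟨le_max_left _ _, max_le (by linarith) (min_le_left _ _)⟩
    · rw [indicator_of_notMem hp, abs_zero]
      exact hM0
  · have hbd : ∀ᵐ p ∂volume.restrict rect, ‖u p‖ₑ ≤ M := by
      have h := hu.2.2.1
      rw [eLpNorm_exponent_top] at h
      filter_upwards [ae_le_eLpNormEssSup (f := u) (μ := volume.restrict rect)] with p hp
      exact hp.trans h
    filter_upwards [ae_imp_of_ae_restrict hm.ae_eq_mk, ae_imp_of_ae_restrict hbd] with p h1 h2
    by_cases hp : p ∈ Icc (0 : ℝ) ρ ×ˢ Icc (-1 : ℝ) 1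
    · have h3 : ‖u p‖₊ ≤ M := by
        have := h2 (hsub hp)
        rwa [enorm_eq_nnnorm, ENNReal.coe_le_coe] at this
      have h4 : |u p| ≤ M := by
        rw [← Real.norm_eq_abs, ← coe_nnnorm]
        exact_mod_cast h3
      rw [indicator_of_mem hp, ← h1 (hsub hp), min_eq_right (abs_le.1 h4).2,
        max_eq_right (abs_le.1 h4).1]
    · rw [indicator_of_notMem hp, hρ p hp]

lemma IsTestField.neg {φ₁ φ₂ : ℝ × ℝ → ℝ} (h : IsTestField φ₁ φ₂) : IsTestField (-φ₁) (-φ₂) where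
  contDiff_fst := h.contDiff_fst.neg
  contDiff_snd := h.contDiff_snd.neg
  compact_fst := h.compact_fst.neg
  compact_snd := h.compact_snd.neg
  supp_fst := by
    rw [tsupport, Function.support_neg]
    exact h.supp_fst
  supp_snd := by
    rw [tsupport, Function.support_neg]
    exact h.supp_snd
  norm_le := fun p => by simpa using h.norm_le p

lemma divergence_neg (φ₁ φ₂ : ℝ × ℝ → ℝ) (p : ℝ × ℝ) :
    divergence (-φ₁) (-φ₂) p = -divergence φ₁ φ₂ p := by
  simp only [divergence, fderiv_neg]
  simp only [FunLike.coe_neg, Pi.neg_apply]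
  ring

lemma integral_divergence_le (hu : totalVariation u ≤ c) {φ₁ φ₂ : ℝ × ℝ → ℝ}
    (h : IsTestField φ₁ φ₂) : ∫ p in rect, u p * divergence φ₁ φ₂ p ≤ c := by
  have h1 : ENNReal.ofReal (∫ p in rect, u p * divergence φ₁ φ₂ p) ≤ c := by
    refine le_trans ?_ hu
    exact le_iSup_of_le φ₁ (le_iSup_of_le φ₂ (le_iSup_of_le h le_rfl))
  rw [← ENNReal.ofReal_coe_nnreal] at h1
  exact (ENNReal.ofReal_le_ofReal_iff c.2).1 h1

lemma neg_integral_divergence_le (hu : totalVariation u ≤ c) {φ₁ φ₂ : ℝ × ℝ → ℝ}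
    (h : IsTestField φ₁ φ₂) : -∫ p in rect, u p * divergence φ₁ φ₂ p ≤ c := by
  have := integral_divergence_le hu h.neg
  simp_rw [divergence_neg, mul_neg] at this
  rwa [integral_neg] at this

lemma continuous_divergence {φ₁ φ₂ : ℝ × ℝ → ℝ} (h : IsTestField φ₁ φ₂) :
    Continuous (divergence φ₁ φ₂) := by
  have h1 := h.contDiff_fst.continuous_fderiv (by simp)
  have h2 := h.contDiff_snd.continuous_fderiv (by simp)
  unfold divergence
  fun_prop

/-- Almost every line parallel to the first axis meets a null set of the plane in a null set, so the
Abel transform is well defined on classes of functions modulo null sets. -/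
lemma abelTransform_congr_ae (h : u =ᵐ[volume] u') :
    abelTransform u =ᵐ[volume] abelTransform u' := by
  have h1 : ∀ᵐ z : ℝ, ∀ᵐ r : ℝ, u (r, z) = u' (r, z) := by
    refine Measure.ae_ae_of_ae_prod (p := fun q : ℝ × ℝ => u (q.2, q.1) = u' (q.2, q.1)) ?_
    exact (Measure.measurePreserving_swap (μ := (volume : Measure ℝ))
      (ν := (volume : Measure ℝ))).quasiMeasurePreserving.ae h
  have h2 : ∀ᵐ p : ℝ × ℝ, ∀ᵐ r : ℝ, u (r, p.2) = u' (r, p.2) := by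
    rw [Measure.volume_eq_prod]
    exact Measure.quasiMeasurePreserving_snd.ae h1
  filter_upwards [h2] with p hp
  unfold abelTransform
  congr 1
  refine integral_congr_ae (ae_restrict_of_ae ?_)
  filter_upwards [hp] with r hr
  rw [hr]

end Representative

lemma aestronglyMeasurable_abelTransform {c M : ℝ≥0} {u : ℝ × ℝ → ℝ} (hu : u ∈ boundedClass c M)
    (hs : SupportedInside u) : AEStronglyMeasurable (abelTransform u) (volume.restrict rect) := by
  obtain ⟨v, hv, hvu⟩ := exists_isInnerProfile hu hs
  exact hv.aestronglyMeasurable_abelTransform.congr (ae_restrict_of_ae (abelTransform_congr_ae hvu))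

lemma memLp_abelTransform {c M : ℝ≥0} {u : ℝ × ℝ → ℝ} (hu : u ∈ boundedClass c M)
    (hs : SupportedInside u) : MemLp (abelTransform u) 2 (volume.restrict rect) :=
  ⟨aestronglyMeasurable_abelTransform hu hs, hs.abelOn_eq ▸ hu.2.2.2⟩

/-- Stability on the bounded class: the cube of the distance of two elements is at most a multiple of
the distance of their Abel transforms. -/
theorem distU_pow_three_le {c M : ℝ≥0} {u₁ u₂ : ℝ × ℝ → ℝ}
    (h₁ : u₁ ∈ boundedClass c M) (hs₁ : SupportedInside u₁)
    (h₂ : u₂ ∈ boundedClass c M) (hs₂ : SupportedInside u₂) :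
    distU u₁ u₂ ^ 3 ≤ ((8 ^ 3 * (c * M) : ℝ≥0) : ℝ≥0∞) *
      eLpNorm (abelTransform u₁ - abelTransform u₂) 2 (volume.restrict rect) := by
  obtain ⟨v₁, hv₁, hvu₁⟩ := exists_isInnerProfile h₁ hs₁
  obtain ⟨v₂, hv₂, hvu₂⟩ := exists_isInnerProfile h₂ hs₂
  have hv := hv₁.sub hv₂
  have hint : ∀ {v : ℝ × ℝ → ℝ}, IsInnerProfile M v → IntegrableOn v rect := fun hv =>
    Measure.integrableOn_of_bounded (by simp [volume_rect]) hv.measurable.aestronglyMeasurable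
      (Filter.Eventually.of_forall hv.abs_le)
  have hC : ∀ φ₁ φ₂, IsTestField φ₁ φ₂ →
      ∫ p in rect, (v₁ - v₂) p * divergence φ₁ φ₂ p ≤ c + c := fun φ₁ φ₂ h => by
    have hd := (continuous_divergence h).continuousOn (s := rect)
    have hK : IsCompact rect := isCompact_Icc.prod isCompact_Icc
    have e1 : ∫ p in rect, v₁ p * divergence φ₁ φ₂ p = ∫ p in rect, u₁ p * divergence φ₁ φ₂ p :=
      integral_congr_ae (ae_restrict_of_ae (hvu₁.mono fun p hp => by simp only [hp]))
    have e2 : ∫ p in rect, v₂ p * divergence φ₁ φ₂ p = ∫ p in rect, u₂ p * divergence φ₁ φ₂ p :=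
      integral_congr_ae (ae_restrict_of_ae (hvu₂.mono fun p hp => by simp only [hp]))
    simp_rw [Pi.sub_apply, sub_mul]
    rw [integral_sub ((hint hv₁).mul_continuousOn hd hK) ((hint hv₂).mul_continuousOn hd hK),
      e1, e2]
    linarith [integral_divergence_le h₁.2.1 h, neg_integral_divergence_le h₂.2.1 h]
  have hA : abelTransform (v₁ - v₂) =ᵐ[volume.restrict rect]
      abelTransform u₁ - abelTransform u₂ := by
    filter_upwards [ae_restrict_mem measurableSet_rect,
      ae_restrict_of_ae (abelTransform_congr_ae hvu₁),
      ae_restrict_of_ae (abelTransform_congr_ae hvu₂)] with p hp e1 e2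
    rw [hv₁.abelTransform_sub hv₂ hp.1.1, e1, e2, Pi.sub_apply]
  have hd : distU u₁ u₂ = eLpNorm (axisymmetric (v₁ - v₂)) 2 (volume.restrict cylinder) := by
    refine eLpNorm_congr_ae (ae_restrict_of_ae ?_)
    filter_upwards [ae_axisymmetric hvu₁, ae_axisymmetric hvu₂] with p e1 e2
    simp only [axisymmetric, Pi.sub_apply, e1, e2]
  have hfin : eLpNorm (abelTransform (v₁ - v₂)) 2 (volume.restrict rect) ≠ ∞ := by
    rw [eLpNorm_congr_ae hA]
    exact ((memLp_abelTransform h₁ hs₁).sub (memLp_abelTransform h₂ hs₂)).eLpNorm_ne_top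
  have key := hv.eLpNorm_axisymmetric_pow_three_le (by positivity) hC hfin
  rw [← hd, eLpNorm_congr_ae hA] at key
  refine key.trans ?_
  gcongr
  rw [← ENNReal.ofReal_coe_nnreal]
  refine ENNReal.ofReal_le_ofReal ?_
  push_cast
  have : (0 : ℝ) ≤ c * M := by positivity
  nlinarith

/-- The estimate against noisy data, by the triangle inequality. -/
theorem distU_pow_three_le_add {c M : ℝ≥0} {u₁ u₂ η : ℝ × ℝ → ℝ}
    (h₁ : u₁ ∈ boundedClass c M) (hs₁ : SupportedInside u₁)
    (h₂ : u₂ ∈ boundedClass c M) (hs₂ : SupportedInside u₂)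
    (hη : AEStronglyMeasurable η (volume.restrict rect)) :
    distU u₁ u₂ ^ 3 ≤ ((8 ^ 3 * (c * M) : ℝ≥0) : ℝ≥0∞) *
      (eLpNorm (abelTransform u₁ - (abelTransform u₂ + η)) 2 (volume.restrict rect) +
        eLpNorm η 2 (volume.restrict rect)) := by
  refine (distU_pow_three_le h₁ hs₁ h₂ hs₂).trans (mul_le_mul_right ?_ _)
  have e : abelTransform u₁ - abelTransform u₂ =
      (abelTransform u₁ - (abelTransform u₂ + η)) + η := by
    ext p
    simp only [Pi.sub_apply, Pi.add_apply]
    ring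
  conv_lhs => rw [e]
  exact eLpNorm_add_le ((aestronglyMeasurable_abelTransform h₁ hs₁).sub
    ((aestronglyMeasurable_abelTransform h₂ hs₂).add hη)) hη one_le_two

lemma rpow_third_le_of_le {d E : ℝ≥0∞} {K x : ℝ≥0}
    (h : d ≤ ((K ^ 3 * x : ℝ≥0) : ℝ≥0∞) * E) :
    d ^ (1 / 3 : ℝ) ≤ ((K * x ^ (1 / 3 : ℝ) : ℝ≥0) : ℝ≥0∞) * E ^ (1 / 3 : ℝ) := by
  refine (ENNReal.rpow_le_rpow h (by norm_num)).trans (le_of_eq ?_)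
  rw [ENNReal.mul_rpow_of_nonneg _ _ (by norm_num), ← ENNReal.coe_rpow_of_nonneg _ (by norm_num),
    NNReal.mul_rpow, ← NNReal.rpow_natCast, ← NNReal.rpow_mul]
  norm_num

lemma rpow_third_pow_three (d : ℝ≥0∞) : (d ^ 3) ^ (1 / 3 : ℝ) = d := by
  rw [← ENNReal.rpow_natCast, ← ENNReal.rpow_mul]
  norm_num

/-! ### The noise -/

lemma eLpNorm_le_of_average_sq_le {η : ℝ × ℝ → ℝ} {σ : ℝ≥0}
    (hη : MemLp η 2 (volume.restrict rect)) (h : (⨍ p in rect, η p ^ 2) ≤ (σ : ℝ) ^ 2) :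
    eLpNorm η 2 (volume.restrict rect) ≤ ENNReal.ofReal (Real.sqrt 2 * σ) := by
  rw [setAverage_eq, Measure.real, volume_rect, ENNReal.toReal_ofNat, smul_eq_mul,
    inv_mul_le_iff₀ two_pos] at h
  refine (ENNReal.pow_le_pow_left_iff two_ne_zero).1 ?_
  rw [eLpNorm_two_sq, ← ENNReal.ofReal_pow (by positivity), mul_pow, Real.sq_sqrt zero_le_two]
  refine le_trans (le_of_eq ?_) (ENNReal.ofReal_le_ofReal h)
  rw [ofReal_integral_eq_lintegral_ofReal hη.integrable_sq
    (Filter.Eventually.of_forall fun p => sq_nonneg _)]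
  refine lintegral_congr fun p => ?_
  rw [← sq_abs, ENNReal.ofReal_pow (abs_nonneg _), Real.enorm_eq_ofReal_abs]

lemma lintegral_sq_gaussianReal (σ : ℝ≥0) :
    ∫⁻ x, ‖x‖ₑ ^ 2 ∂gaussianReal 0 (σ ^ 2) = (σ : ℝ≥0∞) ^ 2 := by
  have h := ofReal_variance (memLp_id_gaussianReal (μ := 0) (v := σ ^ 2) 2)
  rw [variance_id_gaussianReal, evariance] at h
  simp only [id, integral_id_gaussianReal, sub_zero] at h
  rw [← h, ENNReal.ofReal_coe_nnreal, ENNReal.coe_pow]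

section Random

variable {X : Type*} [MeasurableSpace X] {P : Measure X}

lemma measurable_eLpNorm_two {η : X → ℝ × ℝ → ℝ} (hη : Measurable (Function.uncurry η)) :
    Measurable fun ω => eLpNorm (η ω) 2 (volume.restrict rect) := by
  have h : Measurable fun ω => ∫⁻ p in rect, ‖η ω p‖ₑ ^ 2 :=
    Measurable.lintegral_prod_right' (f := fun q : X × (ℝ × ℝ) => ‖η q.1 q.2‖ₑ ^ 2)
      (hη.enorm.pow_const 2)
  have e : (fun ω => eLpNorm (η ω) 2 (volume.restrict rect)) =
      fun ω => (∫⁻ p in rect, ‖η ω p‖ₑ ^ 2) ^ (1 / 2 : ℝ) := by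
    ext ω
    rw [← eLpNorm_two_sq, ← ENNReal.rpow_natCast, ← ENNReal.rpow_mul]
    norm_num
  rw [e]
  exact h.pow_const _

lemma lintegral_eLpNorm_sq [IsProbabilityMeasure P] {η : X → ℝ × ℝ → ℝ} {σ : ℝ≥0}
    (hη : Measurable (Function.uncurry η))
    (hG : ∀ᵐ p ∂(volume.restrict rect), P.map (fun ω => η ω p) = gaussianReal 0 (σ ^ 2)) :
    ∫⁻ ω, eLpNorm (η ω) 2 (volume.restrict rect) ^ 2 ∂P = 2 * (σ : ℝ≥0∞) ^ 2 := by
  simp_rw [eLpNorm_two_sq]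
  rw [lintegral_lintegral_swap (f := fun ω p => ‖η ω p‖ₑ ^ 2) (hη.enorm.pow_const 2).aemeasurable]
  have : ∀ᵐ p ∂(volume.restrict rect), ∫⁻ ω, ‖η ω p‖ₑ ^ 2 ∂P = (σ : ℝ≥0∞) ^ 2 := by
    filter_upwards [hG] with p hp
    rw [← lintegral_sq_gaussianReal, ← hp,
      lintegral_map (measurable_enorm.pow_const 2) hη.of_uncurry_right]
  rw [lintegral_congr_ae this, lintegral_const, Measure.restrict_apply_univ, volume_rect, mul_comm]

/-- The Cauchy-Schwarz inequality against a constant, on a probability space. -/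
lemma lintegral_le_of_lintegral_sq_eq [IsProbabilityMeasure P] {f : X → ℝ≥0∞} (hf : Measurable f)
    {σ : ℝ≥0} (h : ∫⁻ ω, f ω ^ 2 ∂P = 2 * (σ : ℝ≥0∞) ^ 2) :
    ∫⁻ ω, f ω ∂P ≤ ENNReal.ofReal (Real.sqrt 2 * σ) := by
  have h1 := ENNReal.lintegral_mul_le_Lp_mul_Lq P Real.HolderConjugate.two_two
    hf.aemeasurable (aemeasurable_const (b := (1 : ℝ≥0∞)))
  have h2 : (ENNReal.ofReal (Real.sqrt 2 * σ)) ^ 2 = 2 * (σ : ℝ≥0∞) ^ 2 := by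
    rw [← ENNReal.ofReal_pow (by positivity), mul_pow, Real.sq_sqrt zero_le_two,
      ENNReal.ofReal_mul zero_le_two, ENNReal.ofReal_pow (NNReal.coe_nonneg σ),
      ENNReal.ofReal_coe_nnreal]
    simp
  simp only [Pi.mul_apply, mul_one, ENNReal.rpow_two, h, ← h2, ENNReal.one_rpow, one_pow,
    lintegral_const, measure_univ] at h1
  refine h1.trans (le_of_eq ?_)
  rw [← ENNReal.rpow_natCast, ← ENNReal.rpow_mul]
  norm_num

end Random

end AbelTV

theorem mainTheorem3 :
    ∃ K : ℝ≥0,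
      -- `V` is the class over which the regularized functional is minimized
      ∀ (V : Set (ℝ × ℝ → ℝ)), V ⊆ AbelTV.bvSpace →
      ∀ (c M σ : ℝ≥0) (lam : ℝ), 0 < lam →
      ∀ u₀ : ℝ × ℝ → ℝ, u₀ ∈ AbelTV.boundedClass c M → AbelTV.SupportedInside u₀ →
        -- a fixed noise with empirical mean square at most `σ²` over `Ω`
        (∀ η uStar : ℝ × ℝ → ℝ,
          MemLp η 2 (volume.restrict AbelTV.rect) →
          (⨍ p in AbelTV.rect, η p ^ 2) ≤ (σ : ℝ) ^ 2 →
          AbelTV.IsTVMinimizer V lam (AbelTV.abelTransform u₀ + η) uStar →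
          uStar ∈ AbelTV.boundedClass c M → AbelTV.SupportedInside uStar →
          AbelTV.distU uStar u₀ ≤
            ((K * (c * M) ^ (1 / 3 : ℝ) : ℝ≥0) : ℝ≥0∞) *
              (eLpNorm (AbelTV.abelTransform uStar - (AbelTV.abelTransform u₀ + η)) 2
                  (volume.restrict AbelTV.rect) +
                ENNReal.ofReal (Real.sqrt 2 * σ)) ^ (1 / 3 : ℝ)) ∧
        -- a random noise field with `η (p) ∼ Normal (0, σ²)` at the points `p` of `Ω`
        (∀ (X : Type*) (_ : MeasurableSpace X) (P : Measure X), IsProbabilityMeasure P →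
          ∀ η uStar : X → ℝ × ℝ → ℝ,
          Measurable (Function.uncurry η) → Measurable (Function.uncurry uStar) →
          (∀ᵐ p ∂(volume.restrict AbelTV.rect),
            P.map (fun ω => η ω p) = gaussianReal 0 (σ ^ 2)) →
          (∀ᵐ ω ∂P,
            AbelTV.IsTVMinimizer V lam (AbelTV.abelTransform u₀ + η ω) (uStar ω) ∧
            uStar ω ∈ AbelTV.boundedClass c M ∧ AbelTV.SupportedInside (uStar ω)) →
          (∫⁻ ω, eLpNorm (η ω) 2 (volume.restrict AbelTV.rect) ^ 2 ∂P = 2 * (σ : ℝ≥0∞) ^ 2) ∧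
          (∀ᵐ ω ∂P, AbelTV.distU (uStar ω) u₀ ≤
            ((K * (c * M) ^ (1 / 3 : ℝ) : ℝ≥0) : ℝ≥0∞) *
              (eLpNorm (AbelTV.abelTransform (uStar ω) - (AbelTV.abelTransform u₀ + η ω)) 2
                  (volume.restrict AbelTV.rect) +
                eLpNorm (η ω) 2 (volume.restrict AbelTV.rect)) ^ (1 / 3 : ℝ)) ∧
          (∫⁻ ω, AbelTV.distU (uStar ω) u₀ ^ 3 ∂P) ^ (1 / 3 : ℝ) ≤
            ((K * (c * M) ^ (1 / 3 : ℝ) : ℝ≥0) : ℝ≥0∞) *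
              ((∫⁻ ω, eLpNorm (AbelTV.abelTransform (uStar ω) -
                    (AbelTV.abelTransform u₀ + η ω)) 2 (volume.restrict AbelTV.rect) ∂P) +
                ENNReal.ofReal (Real.sqrt 2 * σ)) ^ (1 / 3 : ℝ)) := by
  refine ⟨8, fun V _ c M σ lam _ u₀ hu₀ hs₀ => ⟨fun η uStar hη hσ _ hu hs => ?_,
    fun X _ P hP η uStar hη _ hG hae => ?_⟩⟩
  · have h := AbelTV.distU_pow_three_le_add hu hs hu₀ hs₀ hη.1
    rw [← AbelTV.rpow_third_pow_three (AbelTV.distU uStar u₀)]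
    refine AbelTV.rpow_third_le_of_le (h.trans ?_)
    gcongr
    exact AbelTV.eLpNorm_le_of_average_sq_le hη hσ
  · have hsq := AbelTV.lintegral_eLpNorm_sq hη hG
    have hbound : ∀ᵐ ω ∂P, AbelTV.distU (uStar ω) u₀ ^ 3 ≤
        ((8 ^ 3 * (c * M) : ℝ≥0) : ℝ≥0∞) *
          (eLpNorm (AbelTV.abelTransform (uStar ω) - (AbelTV.abelTransform u₀ + η ω)) 2
            (volume.restrict AbelTV.rect) + eLpNorm (η ω) 2 (volume.restrict AbelTV.rect)) := by
      filter_upwards [hae] with ω hω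
      exact AbelTV.distU_pow_three_le_add hω.2.1 hω.2.2 hu₀ hs₀
        hη.of_uncurry_left.aestronglyMeasurable
    refine ⟨hsq, ?_, ?_⟩
    · filter_upwards [hbound] with ω hω
      rw [← AbelTV.rpow_third_pow_three (AbelTV.distU (uStar ω) u₀)]
      exact AbelTV.rpow_third_le_of_le hω
    · refine AbelTV.rpow_third_le_of_le ((lintegral_mono_ae hbound).trans ?_)
      have hm := AbelTV.measurable_eLpNorm_two hη
      rw [lintegral_const_mul' _ _ ENNReal.coe_ne_top, lintegral_add_right _ hm]
      gcongr
      exact AbelTV.lintegral_le_of_lintegral_sq_eq hm hsq
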